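/- Let $d\ge 0$ and let $p$ be an irreducible, translation invariant transition probability on $\mathbb Z^d$. Let $a:\mathbb Z^d\to(0,\infty)$ satisfy $\sum_x a_x<\infty$ and, for some constant $M$, $\sum_y p(x,y)a_y+\sum_y a_y\,p(y,x)\le M a_x$ for every $x$. Put $\|\eta\|=\sum_x\eta(x)a_x$ and $\mathfrak X=\{\eta\in\mathbb N^{\mathbb Z^d}:\|\eta\|<\infty\}$, and let $\mathbf L$ be the space of functions $f:\mathfrak X\to\mathbb R$ with $|f(\eta)-f(\zeta)|\le L\sum_x|\eta(x)-\zeta(x)|a_x$ for some $L\ge 0$ and all $\eta,\zeta\in\mathfrak X$; any such $L$ is called a Lipschitz constant of $f$. The rates of a mass migration zero range process (MM-ZRP) are numbers $g^k_\alpha$ ($k,\alpha\in\mathbb N$) with $g^0_\alpha=0$, $g^k_\alpha\ge 0$ for $0<k\le\alpha$, and $g^k_\alpha=0$ for $k>\alpha$ or $\alpha=0$; throughout they are assumed to satisfy, for some $C>0$, $\sum_{k=1}^{\alpha}k\,g^k_\alpha\le C(\alpha+\beta)$ for all $\alpha>0$, $\beta\ge 0$. With these rates, $k$ particles jump together from $x$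 to $y$ at rate $p(x,y)g^k_{\eta(x)}$, that is, the process has generator $$\mathcal Lf(\eta)=\sum_{x,y}\sum_{k=1}^{\eta(x)}p(x,y)\,g^k_{\eta(x)}\bigl(f(S^k_{x,y}\eta)-f(\eta)\bigr),\qquad f\in\mathbf L,\ \eta\in\mathfrak X,$$ where $S^k_{x,y}\eta$ is obtained from $\eta$ by moving $k$ particles from $x$ to $y$. A Markov semigroup of this MM-ZRP is a family $(S(t))_{t\ge 0}$ of linear maps $\mathbf L\to\mathbf L$ with $S(0)=I$, $S(s+t)=S(s)S(t)$, $S(t)f\ge 0$ for $f\ge 0$, $S(t)1=1$, such that for some constant $c$, whenever $L$ is a Lipschitz constant of $f$, $Le^{ct}$ is one of $S(t)f$, and such that for all $f\in\mathbf L$, $\eta\in\mathfrak X$, $t\ge 0$ the function $s\mapsto\mathcal LS(s)f(\eta)$ is integrable on $[0,t]$ and $S(t)f(\eta)=f(\eta)+\int_0^t\mathcal LS(s)f(\eta)\,ds$. A probability measure $\bar\mu$ on $\mathbb N^{\mathbb Z^d}$ is invariant for it if $\bar\mu(\mathfrak X)=1$ and $\int S(t)f\,d\bar\mu=\int f\,d\bar\mu$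 for every bounded $f\in\mathbf L$ and every $t\ge 0$. Let $\mu$ denote a probability measure on $\mathbb N$ with $\mu(0)>0$ and finite first moment, and let $\bar\mu$ be the product measure on $\mathbb N^{\mathbb Z^d}$ all of whose single site marginals are $\mu$. Consider the condition $$g^k_{\alpha+k}\,\mu(\alpha+k)=\mu(\alpha)\,\frac{\mu(k)}{\mu(0)}\,g^k_k\qquad\text{for all }k\ge 1,\ \alpha\ge 1.\tag{$*$}$$ 1. If $p$ is asymmetric (that is, not symmetric), then for all such rates and $\mu$ and every Markov semigroup of the MM-ZRP, $\bar\mu$ is invariant if and only if $(*)$ holds. 2. If $p$ is symmetric, then $(*)$ is sufficient: for all such rates and $\mu$ and every Markov semigroup of the MM-ZRP, $(*)$ implies that $\bar\mu$ is invariant. It is only sufficient: for this $p$ there are such rates, a Markov semigroup of the corresponding MM-ZRP, and such a $\mu$, for which $\bar\mu$ is invariant but $(*)$ fails. -/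

import Mathlib

open MeasureTheory
open scoped NNReal

namespace MassMigration

/-! ### Transition probabilities, rates and weights -/

/-- `p` is an irreducible transition probability on `X`. -/
structure IsIrreducibleTransition {X : Type*} (p : X → X → ℝ) : Prop where
  nonneg : ∀ x y, 0 ≤ p x y
  hasSum_one : ∀ x, HasSum (fun y => p x y) 1
  irreducible : ∀ x y, Relation.ReflTransGen (fun u v => 0 < p u v) x y

/-- `p` is invariant under translations. -/
def IsTranslationInvariant {X : Type*} [Add X] (p : X → X → ℝ) : Prop :=
  ∀ x y z, p (x + z) (y + z) = p x y

/-- `p` is symmetric. An asymmetric `p` is one that is not symmetric. -/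
def IsSymmetric {X : Type*} (p : X → X → ℝ) : Prop :=
  ∀ x y, p x y = p y x

/-- The weights `a` that define the norm `‖η‖ = ∑ x, η x * a x`: positive, summable, and with
`∑ y, p x y * a y + ∑ y, a y * p y x ≤ M * a x` for some constant `M`. -/
structure IsWeight {X : Type*} (p : X → X → ℝ) (a : X → ℝ) : Prop where
  pos : ∀ x, 0 < a x
  summable : Summable a
  bound : ∃ M : ℝ, ∀ x, (∑' y, p x y * a y) + (∑' y, a y * p y x) ≤ M * a x

/-- Rates of a mass migration process: `g k α β` is the rate (up to the factor `p x y`) at which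
`k` particles jump from a site with `α` particles to a site with `β` particles. -/
structure IsRate (g : ℕ → ℕ → ℕ → ℝ) : Prop where
  zero : ∀ α β, g 0 α β = 0
  nonneg : ∀ k α β, 0 < k → k ≤ α → 0 ≤ g k α β
  eq_zero : ∀ k α β, α < k ∨ α = 0 → g k α β = 0

/-- `∑_{k=1}^α k g k α β ≤ C (α + β)` for all `α > 0`, `β ≥ 0`. -/
def HasLinearGrowth (g : ℕ → ℕ → ℕ → ℝ) : Prop :=
  ∃ C : ℝ, 0 < C ∧ ∀ α β : ℕ, 0 < α →
    ∑ k ∈ Finset.Icc 1 α, (k : ℝ) * g k α β ≤ C * ((α : ℝ) + (β : ℝ))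

/-- Rates of a mass migration zero range process: `g k α` does not depend on the number `β` of
particles at the arrival site. -/
def zeroRangeRate (g : ℕ → ℕ → ℝ) : ℕ → ℕ → ℕ → ℝ :=
  fun k α _ => g k α

/-! ### Configurations and jumps -/

/-- The configurations `η : X → ℕ` with `‖η‖ = ∑ x, η x * a x < ∞`. -/
abbrev Config {X : Type*} (a : X → ℝ) : Type _ :=
  {η : X → ℕ // Summable fun x => (η x : ℝ) * a x}

/-- The configuration after `k` particles have jumped from `x` to `y`; nothing changes if there are
fewer than `k` particles at `x` or if `x = y`. -/
def jump {X : Type*} [DecidableEq X] (x y : X) (k : ℕ) (η : X → ℕ) : X → ℕ :=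
  fun z =>
    if x = y ∨ η x < k then η z
    else if z = x then η x - k
    else if z = y then η y + k
    else η z

theorem summable_jump {X : Type*} [DecidableEq X] {a : X → ℝ} (x y : X) (k : ℕ) {η : X → ℕ}
    (h : Summable fun z => (η z : ℝ) * a z) :
    Summable fun z => (jump x y k η z : ℝ) * a z := by
  refine h.congr_cofinite ?_
  have hfin : ({x, y} : Set X).Finite := Set.toFinite _
  filter_upwards [hfin.compl_mem_cofinite] with z hz
  have h1 : z ≠ x := fun e => hz (by simp [e])
  have h2 : z ≠ y := fun e => hz (by simp [e])
  simp [jump, h1, h2]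

/-- `jump` as a map of the state space into itself. -/
def Config.jump {X : Type*} [DecidableEq X] {a : X → ℝ} (x y : X) (k : ℕ) (η : Config a) :
    Config a :=
  ⟨MassMigration.jump x y k η.1, summable_jump x y k η.2⟩

/-! ### Lipschitz functions -/

/-- `‖η - ζ‖ = ∑ x, |η x - ζ x| * a x`. -/
noncomputable def distance {X : Type*} {a : X → ℝ} (η ζ : Config a) : ℝ :=
  ∑' x, |(η.1 x : ℝ) - (ζ.1 x : ℝ)| * a x

/-- `K ≥ 0` is a Lipschitz constant of `f`. -/
def IsLipConst {X : Type*} {a : X → ℝ} (f : Config a → ℝ) (K : ℝ) : Prop :=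
  0 ≤ K ∧ ∀ η ζ, |f η - f ζ| ≤ K * distance η ζ

/-- The space of Lipschitz functions on the state space. -/
def Lip {X : Type*} (a : X → ℝ) : Submodule ℝ (Config a → ℝ) where
  carrier := {f | ∃ K, IsLipConst f K}
  zero_mem' := ⟨0, le_rfl, fun η ζ => by simp⟩
  add_mem' := by
    rintro f h ⟨K, hK, hf⟩ ⟨K', hK', hh⟩
    refine ⟨K + K', add_nonneg hK hK', fun η ζ => ?_⟩
    have e : (f + h) η - (f + h) ζ = (f η - f ζ) + (h η - h ζ) := by
      simp only [Pi.add_apply]; ring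
    rw [e, add_mul]
    exact (abs_add_le _ _).trans (add_le_add (hf η ζ) (hh η ζ))
  smul_mem' := by
    rintro r f ⟨K, hK, hf⟩
    refine ⟨|r| * K, mul_nonneg (abs_nonneg r) hK, fun η ζ => ?_⟩
    have e : (r • f) η - (r • f) ζ = r * (f η - f ζ) := by
      simp only [Pi.smul_apply, smul_eq_mul]; ring
    rw [e, abs_mul, mul_assoc]
    exact mul_le_mul_of_nonneg_left (hf η ζ) (abs_nonneg r)

/-! ### Generator, semigroup, invariance -/

/-- The infinitesimal generator of the mass migration process. As `g k α β = 0` for `k > α`, the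
sum over `k > 0` is the sum over `1 ≤ k ≤ η x`. -/
noncomputable def generator {X : Type*} [DecidableEq X] {a : X → ℝ} (p : X → X → ℝ)
    (g : ℕ → ℕ → ℕ → ℝ) (f : Config a → ℝ) (η : Config a) : ℝ :=
  ∑' z : X × X, ∑ k ∈ Finset.Icc 1 (η.1 z.1),
    p z.1 z.2 * g k (η.1 z.1) (η.1 z.2) * (f (Config.jump z.1 z.2 k η) - f η)

/-- `S` is the Markov semigroup, on the Lipschitz functions, of the mass migration process with
jump rates `p x y * g k α β`: a semigroup of positive linear operators that preserve constants,
that enlarge Lipschitz constants at most exponentially in time, and that solve Kolmogorov's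
equation `S t f = f + ∫_0^t L (S s f) ds` for the generator `L`. -/
structure IsMarkovSemigroup {X : Type*} [DecidableEq X] {a : X → ℝ} (p : X → X → ℝ)
    (g : ℕ → ℕ → ℕ → ℝ) (S : ℝ≥0 → (Lip a →ₗ[ℝ] Lip a)) : Prop where
  zero : S 0 = LinearMap.id
  add : ∀ s t, S (s + t) = S s ∘ₗ S t
  nonneg : ∀ t (f : Lip a), (∀ η, 0 ≤ f.1 η) → ∀ η, 0 ≤ (S t f).1 η
  one : ∀ t (f : Lip a), (∀ η, f.1 η = 1) → ∀ η, (S t f).1 η = 1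
  lipschitz : ∃ c : ℝ, ∀ (t : ℝ≥0) (f : Lip a) (K : ℝ),
    IsLipConst f.1 K → IsLipConst (S t f).1 (K * Real.exp (c * t))
  kolmogorov : ∀ (t : ℝ≥0) (f : Lip a) (η : Config a),
    IntervalIntegrable (fun s : ℝ => generator p g (S s.toNNReal f).1 η) volume 0 t ∧
      (S t f).1 η = f.1 η + ∫ s in (0 : ℝ)..t, generator p g (S s.toNNReal f).1 η

/-- The probability measure `ν` on `X → ℕ` is invariant for the process with semigroup `S`: it is
supported on the state space, and `∫ S t f dν = ∫ f dν` for all bounded Lipschitz `f` and all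
`t ≥ 0`. -/
structure IsInvariant {X : Type*} {a : X → ℝ} (S : ℝ≥0 → (Lip a →ₗ[ℝ] Lip a))
    (ν : Measure (X → ℕ)) : Prop where
  supported : ∀ᵐ η ∂ν, Summable fun x => (η x : ℝ) * a x
  integral_eq : ∀ (f : Lip a), (∃ B : ℝ, ∀ η, |f.1 η| ≤ B) → ∀ t : ℝ≥0,
    ∫ η : Config a, (S t f).1 η ∂(ν.comap Subtype.val) =
      ∫ η : Config a, f.1 η ∂(ν.comap Subtype.val)

/-- The translation invariant product measure on `X → ℕ` with single site marginal `μ`. -/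
noncomputable def productMeasure (X : Type*) (μ : Measure ℕ) [IsProbabilityMeasure μ] :
    Measure (X → ℕ) :=
  Measure.infinitePi fun _ : X => μ

/-- `g^k_{α+k} μ(α+k) = μ(α) (μ(k) / μ(0)) g^k_k` for all `k, α ≥ 1`. -/
def ProductCondition (g : ℕ → ℕ → ℝ) (μ : Measure ℕ) : Prop :=
  ∀ k α : ℕ, 1 ≤ k → 1 ≤ α →
    g k (α + k) * μ.real {α + k} = μ.real {α} * (μ.real {k} / μ.real {0}) * g k k

/-- Rates and marginal of a mass migration zero range process started from a product measure:
`g` are nonnegative rates of linear growth, `μ(0) > 0`, and `μ` has a finite first moment. -/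
structure IsAdmissible (g : ℕ → ℕ → ℝ) (μ : Measure ℕ) : Prop where
  rate : IsRate (zeroRangeRate g)
  growth : HasLinearGrowth (zeroRangeRate g)
  zero_pos : 0 < μ.real {0}
  moment : Integrable (fun n : ℕ => (n : ℝ)) μ

end MassMigration

open Filter Topology
open scoped ENNReal

namespace MassMigration

variable {X : Type*} {a : X → ℝ}

/-! ### The distance on configurations -/

/-! Sufficiency. The case α = 0 of the condition is automatic, so g^k_{j+k} μ(j+k) = r_k μ(j) for
all j ≥ 0, with r_k = μ(k) g^k_k / μ(0). Under the product measure, weighting by the rate of a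
k-jump from x therefore amounts to adding k particles at x (`integral_weight_mul`). The jump then
carries exactly these particles to y, so the pair (x, y) contributes H y - H x to the mean of the
generator, with H summable (`exists_integral_pairGen_eq`). Translation invariance gives p unit
column sums besides its unit row sums, and the sum of p(x,y) (H y - H x) vanishes. This holds for
every Lipschitz function, in particular for each S(s) f, whose integral is thus constant in s.

Necessity. Invariance makes the generator integrate to zero on bounded Lipschitz functions. The test
functions are products u(η(x)) v(η(y)) of mean-zero factors supported on {0, n} and {0, b}. A jump
that misses x or y leaves a centered factor untouched and contributes nothing, so p(x,y) T(n,b) +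
p(y,x) T(b,n) = 0, where T(n,b) combines the defects of the condition for k ≤ b. Together with the
equation for (b, n) this is a 2 × 2 system of determinant p(x,y)² - p(y,x)², nonzero for a suitable
pair if p is asymmetric. Hence T = 0, and the defects vanish by induction on k
(`productCondition_of_integral_generator`).

Symmetric p. With μ(n) = 2^{-(n+1)}, jumps of two particles at rate one satisfy the condition.
Changing the jump size to 1 at occupation number 3 and to 3 at occupation number 4 adds to the mean
of each pair a term antisymmetric in (x, y) (`integral_pairGen_singleJumpRate`), which cancels after
summation against a symmetric p although the condition now fails. A semigroup for these rates is
built from finitely many active pairs: bounded operators on functions of growth 1 + ‖η‖ are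
exponentiated, and Duhamel's formula gives convergence as the set of pairs grows
(`isMarkovSemigroup_limitSemigroup`). -/

theorem summable_distance (ha : ∀ x, 0 < a x) (η ζ : Config a) :
    Summable fun x => |(η.1 x : ℝ) - (ζ.1 x : ℝ)| * a x := by
  refine Summable.of_nonneg_of_le (fun x => mul_nonneg (abs_nonneg _) (ha x).le) (fun x => ?_)
    (η.2.add ζ.2)
  rw [← add_mul]
  refine mul_le_mul_of_nonneg_right ?_ (ha x).le
  refine (abs_sub _ _).trans ?_
  simp

theorem distance_nonneg (ha : ∀ x, 0 < a x) (η ζ : Config a) : 0 ≤ distance η ζ :=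
  tsum_nonneg fun x => mul_nonneg (abs_nonneg _) (ha x).le

theorem distance_le_of_hasSum (ha : ∀ x, 0 < a x) {η ζ : Config a} {b : X → ℝ} {B : ℝ}
    (hb : HasSum b B) (h : ∀ x, |(η.1 x : ℝ) - (ζ.1 x : ℝ)| * a x ≤ b x) : distance η ζ ≤ B :=
  hasSum_le h (summable_distance ha η ζ).hasSum hb

theorem mul_le_distance (ha : ∀ x, 0 < a x) (η ζ : Config a) (x : X) :
    |(η.1 x : ℝ) - (ζ.1 x : ℝ)| * a x ≤ distance η ζ :=
  (summable_distance ha η ζ).le_tsum x fun y _ => mul_nonneg (abs_nonneg _) (ha y).le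

/-- The empty configuration. -/
def Config.empty : Config a := ⟨0, by simp⟩

/-- `‖η‖ = ∑ x, η x * a x`. -/
noncomputable def mass (η : Config a) : ℝ := ∑' x, (η.1 x : ℝ) * a x

theorem mass_nonneg (ha : ∀ x, 0 < a x) (η : Config a) : 0 ≤ mass η :=
  tsum_nonneg fun x => mul_nonneg (Nat.cast_nonneg _) (ha x).le

theorem distance_empty (η : Config a) : distance η Config.empty = mass η := by
  unfold distance mass Config.empty
  exact tsum_congr fun x => by simp

theorem mass_le_add_distance (ha : ∀ x, 0 < a x) (η ζ : Config a) :
    mass η ≤ mass ζ + distance η ζ := by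
  unfold mass distance
  rw [← ζ.2.tsum_add (summable_distance ha η ζ)]
  refine η.2.tsum_le_tsum (fun x => ?_) (ζ.2.add (summable_distance ha η ζ))
  rw [← add_mul]
  refine mul_le_mul_of_nonneg_right ?_ (ha x).le
  have := le_abs_self ((η.1 x : ℝ) - (ζ.1 x : ℝ))
  linarith

theorem IsLipConst.abs_le {f : Config a → ℝ} {K : ℝ} (hf : IsLipConst f K) (η : Config a) :
    |f η| ≤ |f Config.empty| + K * mass η := by
  have h := hf.2 η Config.empty
  rw [distance_empty] at h
  have := abs_add_le (f η - f Config.empty) (f Config.empty)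
  rw [sub_add_cancel] at this
  linarith

/-! ### Resampling, adding and moving particles at single sites. -/

section Moves

variable [DecidableEq X]

/-- The configuration whose value at `x` is replaced by `n`. -/
def Config.upd (x : X) (n : ℕ) (η : Config a) : Config a :=
  ⟨Function.update η.1 x n, by
    refine η.2.congr_cofinite ?_
    filter_upwards [(Set.finite_singleton x).compl_mem_cofinite] with z hz
    rw [Function.update_of_ne (by simpa using hz)]⟩

/-- The configuration with `k` more particles at `x`. -/
def Config.addAt (x : X) (k : ℕ) (η : Config a) : Config a := Config.upd x (η.1 x + k) η

theorem Config.upd_apply (x z : X) (n : ℕ) (η : Config a) :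
    (Config.upd x n η).1 z = if z = x then n else η.1 z := by
  simp [Config.upd, Function.update_apply]

theorem Config.upd_upd (x : X) (m n : ℕ) (η : Config a) :
    Config.upd x m (Config.upd x n η) = Config.upd x m η := by
  apply Subtype.ext; funext z; simp only [Config.upd_apply]; split_ifs <;> rfl

theorem Config.addAt_apply (x z : X) (n : ℕ) (η : Config a) :
    (Config.addAt x n η).1 z = if z = x then η.1 x + n else η.1 z := by
  simp [Config.addAt, Config.upd_apply]

theorem Config.upd_comm {x y : X} (h : x ≠ y) (m n : ℕ) (η : Config a) :
    Config.upd x m (Config.upd y n η) = Config.upd y n (Config.upd x m η) := by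
  apply Subtype.ext; funext z; simp only [Config.upd_apply]
  by_cases h1 : z = x <;> by_cases h2 : z = y <;> simp_all

theorem Config.jump_apply (x y z : X) (k : ℕ) (η : Config a) :
    (Config.jump x y k η).1 z = if x = y ∨ η.1 x < k then η.1 z
    else if z = x then η.1 x - k
    else if z = y then η.1 y + k
    else η.1 z := rfl

theorem Config.jump_self (x : X) (k : ℕ) (η : Config a) : Config.jump x x k η = η := by
  apply Subtype.ext; funext z; simp [Config.jump_apply]

theorem Config.jump_eq {x y : X} (h : x ≠ y) {k : ℕ} {η : Config a} (hk : k ≤ η.1 x) :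
    Config.jump x y k η = Config.addAt y k (Config.upd x (η.1 x - k) η) := by
  apply Subtype.ext; funext z
  simp only [Config.jump_apply, Config.addAt_apply, Config.upd_apply]
  simp only [h, not_lt.2 hk, or_self, if_false, h.symm]
  by_cases h1 : z = x
  · subst h1; simp [h]
  · simp [h1]

theorem Config.jump_addAt {x y : X} (h : x ≠ y) (k : ℕ) (η : Config a) :
    Config.jump x y k (Config.addAt x k η) = Config.addAt y k η := by
  rw [Config.jump_eq h (by simp [Config.addAt_apply])]
  apply Subtype.ext; funext z
  simp only [Config.addAt_apply, Config.upd_apply]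
  by_cases h1 : z = x
  · subst h1; simp [h]
  · simp [h1, h.symm]

theorem distance_upd_le (ha : ∀ x, 0 < a x) (x : X) (n : ℕ) (η : Config a) :
    distance (Config.upd x n η) η ≤ |(n : ℝ) - η.1 x| * a x := by
  refine distance_le_of_hasSum ha (hasSum_ite_eq x (|(n : ℝ) - η.1 x| * a x)) fun z => ?_
  rw [Config.upd_apply]
  split_ifs with h
  · rw [h]
  · simp

theorem distance_addAt_le (ha : ∀ x, 0 < a x) (x : X) (k : ℕ) (η : Config a) :
    distance (Config.addAt x k η) η ≤ k * a x := by
  refine (distance_upd_le ha x _ η).trans (le_of_eq ?_)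
  simp

theorem distance_jump_le (ha : ∀ x, 0 < a x) (x y : X) (k : ℕ) (η : Config a) :
    distance (Config.jump x y k η) η ≤ k * (a x + a y) := by
  rw [mul_add]
  refine distance_le_of_hasSum ha ((hasSum_ite_eq x ((k : ℝ) * a x)).add
    (hasSum_ite_eq y ((k : ℝ) * a y))) fun z => ?_
  have hx : (0 : ℝ) ≤ k * a x := mul_nonneg (Nat.cast_nonneg _) (ha x).le
  have hy : (0 : ℝ) ≤ k * a y := mul_nonneg (Nat.cast_nonneg _) (ha y).le
  rw [Config.jump_apply]
  by_cases h : x = y ∨ η.1 x < k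
  · rw [if_pos h]; simp only [sub_self, abs_zero, zero_mul]
    split_ifs <;> positivity
  · push Not at h
    rw [if_neg (by push Not; exact h)]
    by_cases h1 : z = x
    · subst h1
      simp only [if_true, if_neg h.1]
      rw [Nat.cast_sub h.2]; simp
    · rw [if_neg h1, if_neg h1]
      by_cases h2 : z = y
      · subst h2; simp
      · simp [h2]

/-- The pair part of the generator: jumps from `x` to `y`. -/
noncomputable def pairGen (g : ℕ → ℕ → ℝ) (x y : X) (f : Config a → ℝ) (η : Config a) : ℝ :=
  ∑ k ∈ Finset.Icc 1 (η.1 x), g k (η.1 x) * (f (Config.jump x y k η) - f η)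

theorem generator_zeroRange (p : X → X → ℝ) (g : ℕ → ℕ → ℝ) (f : Config a → ℝ) (η : Config a) :
    generator p (zeroRangeRate g) f η = ∑' z : X × X, p z.1 z.2 * pairGen g z.1 z.2 f η := by
  unfold generator pairGen zeroRangeRate
  refine tsum_congr fun z => ?_
  rw [Finset.mul_sum]
  exact Finset.sum_congr rfl fun k _ => by ring

theorem pairGen_self (g : ℕ → ℕ → ℝ) (x : X) (f : Config a → ℝ) (η : Config a) :
    pairGen g x x f η = 0 := by
  simp [pairGen, Config.jump_self]

theorem IsLipConst.abs_jump_sub_le (ha : ∀ x, 0 < a x) {f : Config a → ℝ} {K : ℝ}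
    (hf : IsLipConst f K) (x y : X) (k : ℕ) (η : Config a) :
    |f (Config.jump x y k η) - f η| ≤ K * (k * (a x + a y)) :=
  (hf.2 _ _).trans (mul_le_mul_of_nonneg_left (distance_jump_le ha x y k η) hf.1)

theorem IsLipConst.abs_addAt_sub_le (ha : ∀ x, 0 < a x) {f : Config a → ℝ} {K : ℝ}
    (hf : IsLipConst f K) (x : X) (k : ℕ) (η : Config a) :
    |f (Config.addAt x k η) - f η| ≤ K * (k * a x) :=
  (hf.2 _ _).trans (mul_le_mul_of_nonneg_left (distance_addAt_le ha x k η) hf.1)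

theorem abs_pairGen_le (ha : ∀ x, 0 < a x) {g : ℕ → ℕ → ℝ} (hg : IsRate (zeroRangeRate g))
    {C : ℝ} (hC : ∀ n : ℕ, ∑ k ∈ Finset.Icc 1 n, (k : ℝ) * g k n ≤ C * n)
    {f : Config a → ℝ} {K : ℝ} (hf : IsLipConst f K) (x y : X) (η : Config a) :
    |pairGen g x y f η| ≤ K * C * (η.1 x * (a x + a y)) := by
  have h0 : 0 ≤ a x + a y := add_nonneg (ha x).le (ha y).le
  calc |pairGen g x y f η|
      ≤ ∑ k ∈ Finset.Icc 1 (η.1 x), |g k (η.1 x) * (f (Config.jump x y k η) - f η)| :=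
        Finset.abs_sum_le_sum_abs _ _
    _ ≤ ∑ k ∈ Finset.Icc 1 (η.1 x), ((k : ℝ) * g k (η.1 x)) * (K * (a x + a y)) := by
        refine Finset.sum_le_sum fun k hk => ?_
        rw [Finset.mem_Icc] at hk
        have hgk : 0 ≤ g k (η.1 x) := hg.nonneg k _ 0 hk.1 hk.2
        rw [abs_mul, abs_of_nonneg hgk]
        calc _ ≤ g k (η.1 x) * (K * (k * (a x + a y))) :=
              mul_le_mul_of_nonneg_left (hf.abs_jump_sub_le ha x y k η) hgk
          _ = _ := by ring
    _ = (∑ k ∈ Finset.Icc 1 (η.1 x), ((k : ℝ) * g k (η.1 x))) * (K * (a x + a y)) := by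
        rw [Finset.sum_mul]
    _ ≤ (C * η.1 x) * (K * (a x + a y)) :=
        mul_le_mul_of_nonneg_right (hC _) (mul_nonneg hf.1 h0)
    _ = _ := by ring

end Moves

theorem HasLinearGrowth.exists_bound {g : ℕ → ℕ → ℝ} (h : HasLinearGrowth (zeroRangeRate g)) :
    ∃ C : ℝ, 0 < C ∧ ∀ n : ℕ, ∑ k ∈ Finset.Icc 1 n, (k : ℝ) * g k n ≤ C * n := by
  obtain ⟨C, hC, h⟩ := h
  refine ⟨C, hC, fun n => ?_⟩
  rcases Nat.eq_zero_or_pos n with rfl | hn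
  · simp
  · simpa [zeroRangeRate] using h n 0 hn

/-! ### Summation against the weights -/

theorem IsWeight.bddAbove {p : X → X → ℝ} (ha : IsWeight p a) : ∃ A, 0 ≤ A ∧ ∀ x, a x ≤ A :=
  ⟨∑' x, a x, tsum_nonneg fun x => (ha.pos x).le,
    fun x => ha.summable.le_tsum x fun y _ => (ha.pos y).le⟩

theorem IsWeight.summable_row {p : X → X → ℝ} (ha : IsWeight p a)
    (hp : IsIrreducibleTransition p) (x : X) : Summable fun y => p x y * a y := by
  obtain ⟨A, -, hA⟩ := ha.bddAbove
  refine Summable.of_nonneg_of_le (fun y => mul_nonneg (hp.nonneg x y) (ha.pos y).le)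
    (fun y => mul_le_mul_of_nonneg_left (hA y) (hp.nonneg x y)) ((hp.hasSum_one x).summable.mul_right A)

theorem IsWeight.exists_row_le {p : X → X → ℝ} (ha : IsWeight p a)
    (hp : IsIrreducibleTransition p) :
    ∃ M, 0 ≤ M ∧ ∀ x, ∑' y, p x y * a y ≤ M * a x := by
  obtain ⟨M, hM⟩ := ha.bound
  refine ⟨|M|, abs_nonneg M, fun x => ?_⟩
  have h1 : 0 ≤ ∑' y, a y * p y x := tsum_nonneg fun y => mul_nonneg (ha.pos y).le (hp.nonneg y x)
  have h2 := hM x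
  have h3 : M * a x ≤ |M| * a x := mul_le_mul_of_nonneg_right (le_abs_self M) (ha.pos x).le
  linarith

/-- The pair sums `∑ p x y * (c x * (a x + a y))` are dominated by `∑ c x * a x`. -/
theorem IsWeight.summable_pair {p : X → X → ℝ} (ha : IsWeight p a)
    (hp : IsIrreducibleTransition p) {M : ℝ} (hM : ∀ x, ∑' y, p x y * a y ≤ M * a x)
    {c : X → ℝ} (hc : ∀ x, 0 ≤ c x) (hs : Summable fun x => c x * a x) :
    (Summable fun z : X × X => p z.1 z.2 * (c z.1 * (a z.1 + a z.2))) ∧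
      ∑' z : X × X, p z.1 z.2 * (c z.1 * (a z.1 + a z.2)) ≤ (1 + M) * ∑' x, c x * a x := by
  have hrow : ∀ x, HasSum (fun y => p x y * (c x * (a x + a y)))
      (c x * (a x + ∑' y, p x y * a y)) := fun x => by
    have h := (((hp.hasSum_one x).mul_right (a x)).add
      (ha.summable_row hp x).hasSum).mul_left (c x)
    rw [one_mul] at h
    exact h.congr_fun fun y => by ring
  have hle : ∀ x, c x * (a x + ∑' y, p x y * a y) ≤ (1 + M) * (c x * a x) := fun x => by
    have := mul_le_mul_of_nonneg_left (hM x) (hc x)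
    nlinarith
  have hs' : Summable fun x => ∑' y, p x y * (c x * (a x + a y)) := by
    refine Summable.of_nonneg_of_le (fun x => ?_) (fun x => ?_) (hs.mul_left (1 + M))
    · exact tsum_nonneg fun y => mul_nonneg (hp.nonneg _ _)
        (mul_nonneg (hc x) (add_nonneg (ha.pos x).le (ha.pos y).le))
    · rw [(hrow x).tsum_eq]; exact hle x
  have hsum : Summable fun z : X × X => p z.1 z.2 * (c z.1 * (a z.1 + a z.2)) := by
    rw [summable_prod_of_nonneg fun z => mul_nonneg (hp.nonneg _ _)
        (mul_nonneg (hc z.1) (add_nonneg (ha.pos z.1).le (ha.pos z.2).le))]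
    exact ⟨fun x => (hrow x).summable, hs'⟩
  refine ⟨hsum, ?_⟩
  rw [hsum.tsum_prod' fun x => (hrow x).summable, ← tsum_mul_left]
  exact hs'.tsum_le_tsum (fun x => by rw [(hrow x).tsum_eq]; exact hle x) (hs.mul_left _)

theorem IsWeight.summable_bound {p : X → X → ℝ} {M : ℝ} (ha : IsWeight p a) (hp : IsIrreducibleTransition p)
    (hM : ∀ x, ∑' y, p x y * a y ≤ M * a x) (η : Config a) (K : ℝ) :
    Summable fun z : X × X => p z.1 z.2 * (K * (η.1 z.1 * (a z.1 + a z.2))) :=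
  ((ha.summable_pair hp hM (c := fun x => (η.1 x : ℝ)) (fun _ => Nat.cast_nonneg _)
    η.2).1.mul_left K).congr fun z => by ring

/-! ### Measurability of Lipschitz functions -/

open Classical in
/-- The configuration that agrees with `η` on `Λ` and is empty outside. -/
noncomputable def Config.trunc (Λ : Finset X) (η : Config a) : Config a :=
  ⟨fun x => if x ∈ Λ then η.1 x else 0, by
    refine (summable_zero (α := ℝ)).congr_cofinite ?_
    filter_upwards [Λ.finite_toSet.compl_mem_cofinite] with z hz
    have : z ∉ Λ := hz
    simp [this]⟩

theorem tendsto_distance_trunc (η : Config a) :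
    Tendsto (fun Λ : Finset X => distance η (Config.trunc Λ η)) atTop (𝓝 0) := by
  classical
  have h := tendsto_tsum_compl_atTop_zero fun x => (η.1 x : ℝ) * a x
  refine h.congr fun Λ => ?_
  rw [distance, ← tsum_subtype_eq_of_support_subset (s := {x | x ∉ Λ})]
  · refine tsum_congr fun x => ?_
    have : (x : X) ∉ Λ := x.2
    simp [Config.trunc, this]
  · intro x hx hx'
    apply hx
    have : x ∈ Λ := by simpa using hx'
    simp [Config.trunc, this]

theorem IsLipConst.tendsto_trunc {f : Config a → ℝ} {K : ℝ} (hf : IsLipConst f K) (η : Config a) :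
    Tendsto (fun Λ : Finset X => f (Config.trunc Λ η)) atTop (𝓝 (f η)) := by
  rw [tendsto_iff_dist_tendsto_zero]
  refine squeeze_zero (fun _ => dist_nonneg) (fun Λ => ?_)
    (by simpa using (tendsto_distance_trunc η).const_mul K)
  rw [Real.dist_eq, abs_sub_comm]
  exact hf.2 _ _

theorem measurable_comp_trunc (Λ : Finset X) (f : Config a → ℝ) :
    Measurable fun η : Config a => f (Config.trunc Λ η) := by
  classical
  let e : (Λ → ℕ) → Config a := fun ξ => ⟨fun x => if h : x ∈ Λ then ξ ⟨x, h⟩ else 0, by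
    refine (summable_zero (α := ℝ)).congr_cofinite ?_
    filter_upwards [Λ.finite_toSet.compl_mem_cofinite] with z hz
    have : z ∉ Λ := hz
    simp [this]⟩
  have h1 : Measurable fun ξ : Λ → ℕ => f (e ξ) := Measurable.of_discrete
  have h2 : Measurable fun η : Config a => fun x : Λ => η.1 x :=
    measurable_pi_lambda _ fun x => (measurable_pi_apply _).comp measurable_subtype_coe
  have h3 : (fun η : Config a => f (Config.trunc Λ η)) =
      (fun ξ : Λ → ℕ => f (e ξ)) ∘ fun η x => η.1 x := by
    funext η
    refine congrArg f (Subtype.ext (funext fun x => ?_))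
    by_cases h : x ∈ Λ <;> simp [Config.trunc, e, h]
  exact h3 ▸ h1.comp h2

/-- A Lipschitz function is the pointwise limit of its values at finite truncations, and each of
these depends on finitely many integer coordinates only. -/
theorem IsLipConst.measurable [Countable X] {f : Config a → ℝ} {K : ℝ} (hf : IsLipConst f K) :
    Measurable f :=
  measurable_of_tendsto_metrizable' atTop (fun Λ : Finset X => measurable_comp_trunc Λ f)
    (tendsto_pi_nhds.2 fun η => hf.tendsto_trunc η)

theorem measurable_eval (x : X) : Measurable fun η : Config a => η.1 x :=
  (measurable_pi_apply x).comp measurable_subtype_coe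

/-- A function of a configuration and a natural number, evaluated at a site. -/
theorem measurable_eval_comp (x : X) {F : ℕ → Config a → ℝ} (hF : ∀ n, Measurable (F n)) :
    Measurable fun η : Config a => F (η.1 x) η := by
  have h : Measurable fun q : ℕ × Config a => F q.1 q.2 := measurable_from_prod_countable_right hF
  exact h.comp ((measurable_eval x).prodMk measurable_id)

section Generator

variable [DecidableEq X]

theorem measurable_jump (x y : X) (k : ℕ) :
    Measurable (Config.jump x y k : Config a → Config a) := by
  refine Measurable.subtype_mk (measurable_pi_lambda _ fun z => ?_)
  have h : Measurable fun q : ℕ × ℕ × ℕ => if x = y ∨ q.1 < k then q.2.2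
      else if z = x then q.1 - k else if z = y then q.2.1 + k else q.2.2 := Measurable.of_discrete
  exact h.comp ((measurable_eval x).prodMk ((measurable_eval y).prodMk (measurable_eval z)))

theorem measurable_upd (x : X) :
    Measurable fun q : ℕ × Config a => Config.upd x q.1 q.2 := by
  refine Measurable.subtype_mk (measurable_pi_lambda _ fun z => ?_)
  simp only [Function.update_apply]
  split_ifs
  · exact measurable_fst
  · exact (measurable_eval z).comp measurable_snd

theorem measurable_addAt (x : X) (k : ℕ) :
    Measurable (Config.addAt x k : Config a → Config a) :=
  (measurable_upd x).comp (((measurable_eval x).add_const k).prodMk measurable_id)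

theorem IsLipConst.measurable_pairGen [Countable X] {f : Config a → ℝ} {K : ℝ}
    (hf : IsLipConst f K) (g : ℕ → ℕ → ℝ) (x y : X) : Measurable (pairGen g x y f) :=
  measurable_eval_comp x (F := fun n η =>
      ∑ k ∈ Finset.Icc 1 n, g k n * (f (Config.jump x y k η) - f η)) fun _ =>
    Finset.measurable_sum _ fun k _ =>
      ((hf.measurable.comp (measurable_jump x y k)).sub hf.measurable).const_mul _

/-! ### The generator on Lipschitz functions -/

variable {p : X → X → ℝ} {g : ℕ → ℕ → ℝ} {C M : ℝ}

theorem abs_term_le (ha : IsWeight p a) (hp : IsIrreducibleTransition p)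
    (hg : IsRate (zeroRangeRate g)) (hC : ∀ n : ℕ, ∑ k ∈ Finset.Icc 1 n, (k : ℝ) * g k n ≤ C * n)
    {f : Config a → ℝ} {K : ℝ} (hf : IsLipConst f K) (η : Config a) (z : X × X) :
    |p z.1 z.2 * pairGen g z.1 z.2 f η| ≤ p z.1 z.2 * (K * C * (η.1 z.1 * (a z.1 + a z.2))) := by
  rw [abs_mul, abs_of_nonneg (hp.nonneg _ _)]
  exact mul_le_mul_of_nonneg_left (abs_pairGen_le ha.pos hg hC hf _ _ _) (hp.nonneg _ _)

theorem hasSum_generator (ha : IsWeight p a) (hp : IsIrreducibleTransition p)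
    (hM : ∀ x, ∑' y, p x y * a y ≤ M * a x)
    (hg : IsRate (zeroRangeRate g)) (hC : ∀ n : ℕ, ∑ k ∈ Finset.Icc 1 n, (k : ℝ) * g k n ≤ C * n)
    {f : Config a → ℝ} {K : ℝ} (hf : IsLipConst f K) (η : Config a) :
    HasSum (fun z : X × X => p z.1 z.2 * pairGen g z.1 z.2 f η)
      (generator p (zeroRangeRate g) f η) := by
  rw [generator_zeroRange]
  exact (Summable.of_norm_bounded (ha.summable_bound hp hM η (K * C))
    fun z => abs_term_le ha hp hg hC hf η z).hasSum

theorem abs_generator_le (ha : IsWeight p a) (hp : IsIrreducibleTransition p)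
    (hM : ∀ x, ∑' y, p x y * a y ≤ M * a x) (hC0 : 0 ≤ C)
    (hg : IsRate (zeroRangeRate g)) (hC : ∀ n : ℕ, ∑ k ∈ Finset.Icc 1 n, (k : ℝ) * g k n ≤ C * n)
    {f : Config a → ℝ} {K : ℝ} (hf : IsLipConst f K) (η : Config a) :
    |generator p (zeroRangeRate g) f η| ≤ K * C * ((1 + M) * mass η) := by
  have h := ha.summable_pair hp hM (c := fun x => (η.1 x : ℝ)) (fun _ => Nat.cast_nonneg _) η.2
  have h1 := (h.1.hasSum.mul_left (K * C))
  rw [generator_zeroRange, ← Real.norm_eq_abs]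
  refine (tsum_of_norm_bounded h1 fun z => ?_).trans
    (mul_le_mul_of_nonneg_left h.2 (mul_nonneg hf.1 hC0))
  rw [Real.norm_eq_abs]
  refine (abs_term_le ha hp hg hC hf η z).trans (le_of_eq (by ring))

theorem IsLipConst.measurable_generator [Countable X] (ha : IsWeight p a)
    (hp : IsIrreducibleTransition p) (hM : ∀ x, ∑' y, p x y * a y ≤ M * a x)
    (hg : IsRate (zeroRangeRate g)) (hC : ∀ n : ℕ, ∑ k ∈ Finset.Icc 1 n, (k : ℝ) * g k n ≤ C * n)
    {f : Config a → ℝ} {K : ℝ} (hf : IsLipConst f K) :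
    Measurable (generator p (zeroRangeRate g) f) :=
  measurable_of_tendsto_metrizable' atTop
    (fun s : Finset (X × X) => Finset.measurable_sum s fun z _ =>
      (hf.measurable_pairGen g z.1 z.2).const_mul (p z.1 z.2))
    (tendsto_pi_nhds.2 fun η => by
      simpa [HasSum] using hasSum_generator ha hp hM hg hC hf η)

end Generator

/-! ### The product measure on configurations -/

/-- Independence in the form used later: a fresh sample at one site does not change the law. On a
finite box, the factor at `x` is read from the new sample and the others from the old configuration.
-/
theorem productMeasure_map_update [DecidableEq X] (μ : Measure ℕ) [IsProbabilityMeasure μ] (x : X) :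
    (μ.prod (productMeasure X μ)).map (fun q : ℕ × (X → ℕ) => Function.update q.2 x q.1) =
      productMeasure X μ := by
  have hm : Measurable fun q : ℕ × (X → ℕ) => Function.update q.2 x q.1 := by
    refine measurable_pi_lambda _ fun z => ?_
    simp only [Function.update_apply]
    split_ifs
    · exact measurable_fst
    · exact (measurable_pi_apply z).comp measurable_snd
  have : IsProbabilityMeasure (productMeasure X μ) := by unfold productMeasure; infer_instance
  refine Measure.eq_infinitePi _ fun s t ht => ?_
  rw [Measure.map_apply hm (MeasurableSet.pi s.countable_toSet fun i _ => ht i)]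
  have hpre : (fun q : ℕ × (X → ℕ) => Function.update q.2 x q.1) ⁻¹' ((s : Set X).pi t) =
      (if x ∈ s then t x else Set.univ) ×ˢ (((s.erase x : Finset X) : Set X).pi t) := by
    ext q
    simp only [Set.mem_preimage, Set.mem_pi, Set.mem_prod, Finset.mem_coe, Finset.mem_erase]
    constructor
    · intro h
      refine ⟨?_, fun i hi => ?_⟩
      · split_ifs with hx
        · simpa using h x hx
        · trivial
      · simpa [Function.update_of_ne hi.1] using h i hi.2
    · rintro ⟨h1, h2⟩ i hi
      by_cases hix : i = x
      · subst hix
        simpa [hi] using h1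
      · simpa [Function.update_of_ne hix] using h2 i ⟨hix, hi⟩
  rw [hpre, Measure.prod_prod, productMeasure, Measure.infinitePi_pi _ fun i _ => ht i]
  split_ifs with hx
  · exact Finset.mul_prod_erase s (fun i => μ (t i)) hx
  · rw [Finset.erase_eq_of_notMem hx]; simp

theorem productMeasure_map_eval (μ : Measure ℕ) [IsProbabilityMeasure μ] (x : X) :
    (productMeasure X μ).map (fun η => η x) = μ :=
  Measure.infinitePi_map_eval _ x

theorem summable_iff_lintegral (ha : ∀ x, 0 < a x) (η : X → ℕ) :
    (Summable fun x => (η x : ℝ) * a x) ↔ ∑' x, ENNReal.ofReal (η x * a x) ≠ ∞ := by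
  have h0 : ∀ x, 0 ≤ (η x : ℝ) * a x := fun x => mul_nonneg (Nat.cast_nonneg _) (ha x).le
  constructor
  · exact fun h => h.tsum_ofReal_ne_top
  · intro h
    refine (ENNReal.summable_toReal h).congr fun x => ?_
    rw [ENNReal.toReal_ofReal (h0 x)]

theorem measurable_tsum_ofReal [Countable X] :
    Measurable fun η : X → ℕ => ∑' x, ENNReal.ofReal (η x * a x) := by
  refine Measurable.tsum fun x => ?_
  have h : Measurable fun n : ℕ => ENNReal.ofReal (n * a x) := Measurable.of_discrete
  exact h.comp (measurable_pi_apply x)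

theorem measurableSet_summable [Countable X] (ha : ∀ x, 0 < a x) :
    MeasurableSet {η : X → ℕ | Summable fun x => (η x : ℝ) * a x} := by
  simp_rw [summable_iff_lintegral ha]
  exact (measurableSet_singleton ∞).compl.preimage measurable_tsum_ofReal

/-- By Tonelli, the expected norm is the first moment of `μ` times the total weight. -/
theorem lintegral_tsum_ne_top [Countable X] (hs : Summable a) (μ : Measure ℕ)
    [IsProbabilityMeasure μ] (hμ : Integrable (fun n : ℕ => (n : ℝ)) μ) :
    ∫⁻ η, ∑' x, ENNReal.ofReal (η x * a x) ∂(productMeasure X μ) ≠ ∞ := by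
  rw [lintegral_tsum]
  · have h : ∀ x, ∫⁻ η, ENNReal.ofReal ((η x : ℝ) * a x) ∂(productMeasure X μ) =
        (∫⁻ n : ℕ, ENNReal.ofReal (n : ℝ) ∂μ) * ENNReal.ofReal (a x) := fun x => by
      have h1 : Measurable fun n : ℕ => ENNReal.ofReal ((n : ℝ) * a x) := Measurable.of_discrete
      have h2 := lintegral_map (μ := productMeasure X μ) h1 (measurable_pi_apply x)
      rw [productMeasure_map_eval] at h2
      rw [← h2, ← lintegral_mul_const _ Measurable.of_discrete]
      refine lintegral_congr fun n => ?_
      rw [ENNReal.ofReal_mul (Nat.cast_nonneg _)]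
    simp_rw [h]
    rw [ENNReal.tsum_mul_left]
    exact ENNReal.mul_ne_top
      (((hasFiniteIntegral_iff_ofReal (Eventually.of_forall fun n => Nat.cast_nonneg n)).1 hμ.2).ne)
      hs.tsum_ofReal_ne_top
  · intro x
    have h1 : Measurable fun n : ℕ => ENNReal.ofReal ((n : ℝ) * a x) := Measurable.of_discrete
    exact (h1.comp (measurable_pi_apply x)).aemeasurable

theorem ae_summable [Countable X] (ha : ∀ x, 0 < a x) (hs : Summable a) (μ : Measure ℕ)
    [IsProbabilityMeasure μ] (hμ : Integrable (fun n : ℕ => (n : ℝ)) μ) :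
    ∀ᵐ η ∂(productMeasure X μ), Summable fun x => (η x : ℝ) * a x := by
  filter_upwards [ae_lt_top measurable_tsum_ofReal (lintegral_tsum_ne_top hs μ hμ)] with η hη
  exact (summable_iff_lintegral ha η).2 hη.ne

/-- The product measure as a measure on the state space. -/
noncomputable def configMeasure (a : X → ℝ) (μ : Measure ℕ) [IsProbabilityMeasure μ] :
    Measure (Config a) :=
  (productMeasure X μ).comap Subtype.val

/-! ### Independence and reweighting under the product measure. -/

section ConfigMeasure

variable [Countable X] (ha : ∀ x, 0 < a x) (hs : Summable a) (μ : Measure ℕ)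
  [IsProbabilityMeasure μ] (hμ : Integrable (fun n : ℕ => (n : ℝ)) μ)

include ha hs hμ

theorem configMeasure_map_val :
    (configMeasure a μ).map Subtype.val = productMeasure X μ := by
  have h := map_comap_subtype_coe (measurableSet_summable ha) (productMeasure X μ)
  exact h.trans (Measure.restrict_eq_self_of_ae_mem (ae_summable ha hs μ hμ))

theorem isProbabilityMeasure_configMeasure : IsProbabilityMeasure (configMeasure a μ) := by
  have : IsProbabilityMeasure (productMeasure X μ) := by unfold productMeasure; infer_instance
  refine ⟨?_⟩
  have h := congrArg (fun m : Measure (X → ℕ) => m Set.univ) (configMeasure_map_val ha hs μ hμ)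
  simpa [Measure.map_apply measurable_subtype_coe MeasurableSet.univ] using h

/-- The state space is measurable, so the inclusion is a measurable embedding and the identity may
be checked after pushing forward to all configurations. -/
theorem configMeasure_map_upd [DecidableEq X] (x : X) :
    (μ.prod (configMeasure a μ)).map (fun q : ℕ × Config a => Config.upd x q.1 q.2) =
      configMeasure a μ := by
  have := isProbabilityMeasure_configMeasure ha hs μ hμ
  have hv := configMeasure_map_val ha hs μ hμ
  have hu : Measurable fun q : ℕ × (X → ℕ) => Function.update q.2 x q.1 := by
    refine measurable_pi_lambda _ fun z => ?_
    simp only [Function.update_apply]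
    split_ifs
    · exact measurable_fst
    · exact (measurable_pi_apply z).comp measurable_snd
  have he : MeasurableEmbedding (Subtype.val : Config a → X → ℕ) :=
    MeasurableEmbedding.subtype_coe (measurableSet_summable ha)
  have key : ((μ.prod (configMeasure a μ)).map
      (fun q : ℕ × Config a => Config.upd x q.1 q.2)).map Subtype.val =
      (configMeasure a μ).map Subtype.val := by
    rw [Measure.map_map measurable_subtype_coe (measurable_upd x), hv,
      ← productMeasure_map_update μ x]
    have hprod := Measure.map_prod_map μ (configMeasure a μ) measurable_id
      (measurable_subtype_coe (p := fun η : X → ℕ => Summable fun x => (η x : ℝ) * a x))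
    rw [Measure.map_id, hv] at hprod
    rw [hprod, Measure.map_map hu (measurable_id.prodMap measurable_subtype_coe)]
    rfl
  calc _ = (((μ.prod (configMeasure a μ)).map
      (fun q : ℕ × Config a => Config.upd x q.1 q.2)).map Subtype.val).comap Subtype.val :=
        (he.comap_map _).symm
    _ = _ := by rw [key, he.comap_map]

theorem configMeasure_map_eval [DecidableEq X] (x : X) :
    (configMeasure a μ).map (fun η => η.1 x) = μ := by
  have h := congrArg (fun m : Measure (X → ℕ) => m.map fun η => η x)
    (configMeasure_map_val ha hs μ hμ)
  rw [Measure.map_map (measurable_pi_apply x) measurable_subtype_coe,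
    productMeasure_map_eval] at h
  exact h

theorem integrable_eval [DecidableEq X] (x : X) {w : ℕ → ℝ} (hw : Integrable w μ) :
    Integrable (fun η : Config a => w (η.1 x)) (configMeasure a μ) := by
  rw [← configMeasure_map_eval ha hs μ hμ x] at hw
  exact hw.comp_measurable (measurable_eval x)

theorem integral_eval [DecidableEq X] (x : X) (w : ℕ → ℝ) :
    ∫ η : Config a, w (η.1 x) ∂(configMeasure a μ) = ∫ n, w n ∂μ := by
  have h := integral_map (μ := configMeasure a μ) (f := w) (measurable_eval x).aemeasurable
    (by exact Measurable.of_discrete.aestronglyMeasurable)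
  rw [configMeasure_map_eval ha hs μ hμ x] at h
  exact h.symm

theorem integrable_mass : Integrable (mass : Config a → ℝ) (configMeasure a μ) := by
  have hm : ∀ η : Config a, mass η = (∑' x, ENNReal.ofReal (η.1 x * a x)).toReal := fun η => by
    rw [ENNReal.tsum_toReal_eq fun x => ENNReal.ofReal_ne_top]
    exact tsum_congr fun x =>
      (ENNReal.toReal_ofReal (mul_nonneg (Nat.cast_nonneg _) (ha x).le)).symm
  have hmeas := (measurable_tsum_ofReal (a := a)).comp
    (measurable_subtype_coe (p := fun η : X → ℕ => Summable fun x => (η x : ℝ) * a x))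
  refine Integrable.congr (integrable_toReal_of_lintegral_ne_top hmeas.aemeasurable ?_)
    (Eventually.of_forall fun η => (hm η).symm)
  have h := lintegral_tsum_ne_top hs μ hμ
  rw [← configMeasure_map_val ha hs μ hμ,
    lintegral_map measurable_tsum_ofReal measurable_subtype_coe] at h
  exact h

theorem IsLipConst.integrable {f : Config a → ℝ} {K : ℝ} (hf : IsLipConst f K) :
    Integrable f (configMeasure a μ) := by
  have := isProbabilityMeasure_configMeasure ha hs μ hμ
  refine Integrable.mono' ((integrable_const |f Config.empty|).add
    ((integrable_mass ha hs μ hμ).const_mul K)) hf.measurable.aestronglyMeasurable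
    (Eventually.of_forall fun η => ?_)
  exact hf.abs_le η

/-- Resampling the value at a site. -/
theorem integral_upd [DecidableEq X] (x : X) {F : Config a → ℝ}
    (hF : Integrable F (configMeasure a μ)) :
    ∫ η, F η ∂(configMeasure a μ) =
      ∫ η, ∫ n, F (Config.upd x n η) ∂μ ∂(configMeasure a μ) := by
  have := isProbabilityMeasure_configMeasure ha hs μ hμ
  have hr := configMeasure_map_upd ha hs μ hμ x
  have hF' := hF
  rw [← hr] at hF'
  conv_lhs => rw [← hr]
  rw [integral_map (measurable_upd x).aemeasurable hF'.1]
  exact integral_prod_symm _ (hF'.comp_measurable (measurable_upd x))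

/-- A function of the value at `x` and a function of the other values are independent. -/
theorem integral_mul_of_upd_eq [DecidableEq X] (x : X) {w : ℕ → ℝ} {H : Config a → ℝ}
    (hH : ∀ n η, H (Config.upd x n η) = H η)
    (hi : Integrable (fun η : Config a => w (η.1 x) * H η) (configMeasure a μ)) :
    ∫ η, w (η.1 x) * H η ∂(configMeasure a μ) =
      (∫ n, w n ∂μ) * ∫ η, H η ∂(configMeasure a μ) := by
  rw [integral_upd ha hs μ hμ x hi, ← integral_const_mul]
  refine integral_congr_ae (Eventually.of_forall fun η => ?_)
  simp only [hH, Config.upd_apply, if_true]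
  exact integral_mul_const _ _

/-- If `w (j + k) μ(j + k) = r μ(j)`, weighting by `w` amounts to adding `k` particles. -/
theorem integral_weight_mul [DecidableEq X] (x : X) {w : ℕ → ℝ} (hw : Integrable w μ) {k : ℕ}
    {r : ℝ} (hw0 : ∀ n < k, w n = 0) (hwr : ∀ j, w (j + k) * μ.real {j + k} = r * μ.real {j})
    {Ψ : Config a → ℝ} {B : ℝ} (hΨ : Measurable Ψ) (hB : ∀ η, |Ψ η| ≤ B) :
    ∫ η, w (η.1 x) * Ψ η ∂(configMeasure a μ) =
      r * ∫ η, Ψ (Config.addAt x k η) ∂(configMeasure a μ) := by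
  have := isProbabilityMeasure_configMeasure ha hs μ hμ
  have hi1 : Integrable (fun η : Config a => w (η.1 x) * Ψ η) (configMeasure a μ) :=
    (integrable_eval ha hs μ hμ x hw).mul_bdd (c := B) hΨ.aestronglyMeasurable
      (Eventually.of_forall hB)
  have hi2 : Integrable (fun η : Config a => Ψ (Config.addAt x k η)) (configMeasure a μ) :=
    Integrable.of_bound (hΨ.comp (measurable_addAt x k)).aestronglyMeasurable B
      (Eventually.of_forall fun η => hB _)
  rw [integral_upd ha hs μ hμ x hi1, integral_upd ha hs μ hμ x hi2, ← integral_const_mul]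
  refine integral_congr_ae (Eventually.of_forall fun η => ?_)
  have hadd : ∀ n, Config.addAt x k (Config.upd x n η) = Config.upd x (n + k) η := fun n => by
    simp [Config.addAt, Config.upd_upd, Config.upd_apply]
  simp only [hadd, Config.upd_apply, if_true]
  -- With the other sites fixed, both sides are sums over the value at `x`. The terms n < k vanish
  -- by `hw0`, and n = j + k matches the rest by `hwr`.
  rw [integral_countable, integral_countable, ← tsum_mul_left]
  · refine (Function.Injective.tsum_eq (add_left_injective k) ?_).symm.trans
      (tsum_congr fun j => ?_)
    · intro n hn
      by_contra h
      apply hn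
      have hnk : n < k := by
        by_contra h'
        exact h ⟨n - k, Nat.sub_add_cancel (not_lt.1 h')⟩
      simp [hw0 n hnk]
    · simp only [smul_eq_mul]
      have := hwr j
      linear_combination Ψ (Config.upd x (j + k) η) * this
  · exact Integrable.of_bound Measurable.of_discrete.aestronglyMeasurable B
      (Eventually.of_forall fun n => hB _)
  · exact hw.mul_bdd (c := B) Measurable.of_discrete.aestronglyMeasurable
      (Eventually.of_forall fun n => hB _)

/-- The part of an integral where `η x = n`. -/
theorem integral_indicator_mul [DecidableEq X] (x : X) (n : ℕ)
    {Ψ : Config a → ℝ} {B : ℝ} (hΨ : Measurable Ψ) (hB : ∀ η, |Ψ η| ≤ B) :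
    ∫ η, (if η.1 x = n then 1 else 0) * Ψ η ∂(configMeasure a μ) =
      μ.real {n} * ∫ η, Ψ (Config.upd x n η) ∂(configMeasure a μ) := by
  have := isProbabilityMeasure_configMeasure ha hs μ hμ
  have hw : Integrable (fun m : ℕ => if m = n then (1 : ℝ) else 0) μ :=
    Integrable.of_bound Measurable.of_discrete.aestronglyMeasurable 1
      (Eventually.of_forall fun m => by split_ifs <;> simp)
  have hu : Measurable fun η : Config a => Config.upd x n η :=
    (measurable_upd x).comp (measurable_const.prodMk measurable_id)
  have hi : Integrable (fun η : Config a => (if η.1 x = n then 1 else 0) * Ψ η)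
      (configMeasure a μ) :=
    (integrable_eval ha hs μ hμ x hw).mul_bdd (c := B) hΨ.aestronglyMeasurable (Eventually.of_forall hB)
  have he : (fun η : Config a => (if η.1 x = n then 1 else 0) * Ψ η) =
      fun η => (if η.1 x = n then 1 else 0) * Ψ (Config.upd x n η) := by
    funext η
    split_ifs with h
    · rw [← h]
      congr 2
      apply Subtype.ext; funext z
      rw [Config.upd_apply]; split_ifs with hz
      · rw [hz]
      · rfl
    · simp
  rw [he] at hi ⊢
  rw [integral_mul_of_upd_eq ha hs μ hμ x (w := fun m => if m = n then 1 else 0)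
    (fun m η => by rw [Config.upd_upd]) hi]
  congr 1
  have : (fun m : ℕ => if m = n then (1 : ℝ) else 0) = Set.indicator {n} 1 := by
    funext m; simp [Set.indicator]
  rw [this, integral_indicator_one (measurableSet_singleton n)]

end ConfigMeasure

/-! ### The integral of the generator -/

theorem hasSum_prod_fst {p : X → X → ℝ} (h0 : ∀ x y, 0 ≤ p x y)
    (h1 : ∀ x, HasSum (fun y => p x y) 1) {H : X → ℝ} (hH : Summable H) :
    HasSum (fun z : X × X => p z.1 z.2 * H z.1) (∑' x, H x) := by
  have hrow : ∀ (G : X → ℝ) x, HasSum (fun y => p x y * G x) (G x) := fun G x => by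
    simpa using (h1 x).mul_right (G x)
  have hs : Summable fun z : X × X => p z.1 z.2 * H z.1 := by
    refine Summable.of_norm ?_
    have : Summable fun z : X × X => p z.1 z.2 * |H z.1| := by
      rw [summable_prod_of_nonneg fun z => mul_nonneg (h0 _ _) (abs_nonneg _)]
      refine ⟨fun x => (hrow (fun x => |H x|) x).summable, ?_⟩
      simp_rw [(hrow (fun x => |H x|) _).tsum_eq]
      exact hH.abs
    refine this.congr fun z => ?_
    rw [norm_mul, Real.norm_eq_abs, Real.norm_eq_abs, abs_of_nonneg (h0 _ _)]
  have := hs.hasSum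
  rwa [hs.tsum_prod' fun x => (hrow H x).summable,
    tsum_congr fun x => (hrow H x).tsum_eq] at this

theorem hasSum_prod_snd {p : X → X → ℝ} (h0 : ∀ x y, 0 ≤ p x y)
    (h1 : ∀ y, HasSum (fun x => p x y) 1) {H : X → ℝ} (hH : Summable H) :
    HasSum (fun z : X × X => p z.1 z.2 * H z.2) (∑' x, H x) :=
  (Equiv.prodComm X X).hasSum_iff.1 (hasSum_prod_fst (p := fun x y => p y x) (fun _ _ => h0 _ _) h1 hH)

/-! ### Moments of the rates. -/

section Rate

variable {g : ℕ → ℕ → ℝ} {C : ℝ} (hg : IsRate (zeroRangeRate g))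
  (hC : ∀ n : ℕ, ∑ k ∈ Finset.Icc 1 n, (k : ℝ) * g k n ≤ C * n)

include hg in
theorem rate_nonneg (k n : ℕ) : 0 ≤ g k n := by
  rcases Nat.eq_zero_or_pos k with rfl | hk
  · exact (hg.zero n 0).ge
  · rcases le_or_gt k n with h | h
    · exact hg.nonneg k n 0 hk h
    · exact (hg.eq_zero k n 0 (Or.inl h)).ge

include hg in
theorem rate_eq_zero {k n : ℕ} (h : n < k) : g k n = 0 := hg.eq_zero k n 0 (Or.inl h)

include hg hC in
theorem mul_rate_le (hC0 : 0 ≤ C) (k n : ℕ) : (k : ℝ) * g k n ≤ C * n := by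
  have h0 : ∀ k : ℕ, 0 ≤ (k : ℝ) * g k n := fun k => mul_nonneg (Nat.cast_nonneg _) (rate_nonneg hg k n)
  rcases Nat.eq_zero_or_pos k with rfl | hk
  · simpa using mul_nonneg hC0 (Nat.cast_nonneg n)
  · rcases le_or_gt k n with h | h
    · exact (Finset.single_le_sum (f := fun k : ℕ => (k : ℝ) * g k n) (fun k _ => h0 k)
        (Finset.mem_Icc.2 ⟨hk, h⟩)).trans (hC n)
    · rw [rate_eq_zero hg h]; simpa using mul_nonneg hC0 (Nat.cast_nonneg n)

include hg hC in
theorem integrable_rate (μ : Measure ℕ)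
    (hμ : Integrable (fun n : ℕ => (n : ℝ)) μ) (hC0 : 0 ≤ C) (k : ℕ) : Integrable (fun n => g k n) μ := by
  rcases Nat.eq_zero_or_pos k with rfl | hk
  · have : (fun n => g 0 n) = fun _ => 0 := funext fun n => hg.zero n 0
    rw [this]; exact integrable_zero _ _ _
  · refine Integrable.mono' (hμ.const_mul C) Measurable.of_discrete.aestronglyMeasurable
      (Eventually.of_forall fun n => ?_)
    rw [Real.norm_eq_abs, abs_of_nonneg (rate_nonneg hg k n)]
    refine le_trans ?_ (mul_rate_le hg hC hC0 k n)
    exact le_mul_of_one_le_left (rate_nonneg hg k n) (by exact_mod_cast hk)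

include hg hC in
-- The linear growth bound ∑ k g^k_n ≤ C n, integrated in n, bounds all partial sums by C times the
-- first moment.
theorem summable_mul_integral_rate (μ : Measure ℕ)
    (hμ : Integrable (fun n : ℕ => (n : ℝ)) μ) (hC0 : 0 ≤ C) :
    Summable fun k : ℕ => (k : ℝ) * ∫ n, g k n ∂μ := by
  refine summable_of_sum_range_le (c := ∫ n : ℕ, C * n ∂μ)
    (fun k => mul_nonneg (Nat.cast_nonneg _) (integral_nonneg fun n => rate_nonneg hg k n))
    fun N => ?_
  simp_rw [← integral_const_mul]
  rw [← integral_finsetSum _ fun k _ => (integrable_rate hg hC μ hμ hC0 k).const_mul _]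
  refine integral_mono (integrable_finsetSum _ fun k _ =>
    (integrable_rate hg hC μ hμ hC0 k).const_mul _) (hμ.const_mul C) fun n => ?_
  refine le_trans ?_ (hC n)
  have h0 : ∀ k : ℕ, 0 ≤ (k : ℝ) * g k n := fun k => mul_nonneg (Nat.cast_nonneg _) (rate_nonneg hg k n)
  calc ∑ k ∈ Finset.range N, (k : ℝ) * g k n
      = ∑ k ∈ (Finset.range N).filter (fun k => 1 ≤ k ∧ k ≤ n), (k : ℝ) * g k n := by
        rw [Finset.sum_filter_of_ne]
        intro k _ hk
        refine ⟨Nat.one_le_iff_ne_zero.2 fun h => hk (by simp [h]), ?_⟩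
        by_contra h
        exact hk (by rw [rate_eq_zero hg (not_le.1 h), mul_zero])
    _ ≤ _ := Finset.sum_le_sum_of_subset_of_nonneg
        (fun k hk => Finset.mem_Icc.2 (Finset.mem_filter.1 hk).2) fun k _ _ => h0 k

include hg in
theorem hasSum_pairGen [DecidableEq X] (f : Config a → ℝ) (x y : X) (η : Config a) :
    HasSum (fun k : ℕ => g k (η.1 x) * (f (Config.jump x y k η) - f η)) (pairGen g x y f η) := by
  refine hasSum_sum_of_ne_finset_zero fun k hk => ?_
  rw [Finset.mem_Icc] at hk
  rcases Nat.eq_zero_or_pos k with rfl | hk0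
  · rw [show g 0 (η.1 x) = 0 from hg.zero _ 0, zero_mul]
  · rw [rate_eq_zero hg (by omega), zero_mul]

end Rate

/-! ### Contribution of a pair of sites to the mean of the generator. -/

section Integral

variable [Countable X] [DecidableEq X] {p : X → X → ℝ} {g : ℕ → ℕ → ℝ} {C M : ℝ}
  (ha : IsWeight p a) (hp : IsIrreducibleTransition p)
  (hM : ∀ x, ∑' y, p x y * a y ≤ M * a x) (hg : IsRate (zeroRangeRate g))
  (hC : ∀ n : ℕ, ∑ k ∈ Finset.Icc 1 n, (k : ℝ) * g k n ≤ C * n)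
  (μ : Measure ℕ) [IsProbabilityMeasure μ] (hμ : Integrable (fun n : ℕ => (n : ℝ)) μ)
  {f : Config a → ℝ} {K : ℝ} (hf : IsLipConst f K)

include ha hg hC hμ hf in
theorem integrable_pairGen (x y : X) : Integrable (pairGen g x y f) (configMeasure a μ) :=
  Integrable.mono' (((integrable_eval ha.pos ha.summable μ hμ x hμ).mul_const
      (a x + a y)).const_mul (K * C)) (hf.measurable_pairGen g x y).aestronglyMeasurable
    (Eventually.of_forall fun η => abs_pairGen_le ha.pos hg hC hf x y η)

include ha hp hM hg hC hμ hf in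
theorem integrable_generator (hC0 : 0 ≤ C) :
    Integrable (generator p (zeroRangeRate g) f) (configMeasure a μ) :=
  Integrable.mono' (((integrable_mass ha.pos ha.summable μ hμ).const_mul (1 + M)).const_mul (K * C))
    (hf.measurable_generator ha hp hM hg hC).aestronglyMeasurable
    (Eventually.of_forall fun η => abs_generator_le ha hp hM hC0 hg hC hf η)

include ha hp hM hg hC hμ hf in
theorem hasSum_integral_generator :
    HasSum (fun z : X × X => p z.1 z.2 * ∫ η, pairGen g z.1 z.2 f η ∂(configMeasure a μ))
      (∫ η, generator p (zeroRangeRate g) f η ∂(configMeasure a μ)) := by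
  have hi : ∀ z : X × X, Integrable (fun η => p z.1 z.2 * pairGen g z.1 z.2 f η)
      (configMeasure a μ) := fun z =>
    (integrable_pairGen ha hg hC μ hμ hf z.1 z.2).const_mul _
  have hsum := (ha.summable_pair hp hM (c := fun _ => 1) (fun _ => zero_le_one)
    (by simpa using ha.summable)).1.mul_left (K * C * ∫ n : ℕ, (n : ℝ) ∂μ)
  have h := hasSum_integral_of_summable_integral_norm hi
    (Summable.of_nonneg_of_le (fun z => integral_nonneg fun η => norm_nonneg _) (fun z => ?_) hsum)
  · simp_rw [generator_zeroRange]
    simpa only [integral_const_mul] using h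
  · have h1 := integral_mono (hi z).norm
      ((((integrable_eval ha.pos ha.summable μ hμ z.1 hμ).mul_const
        (a z.1 + a z.2)).const_mul (K * C)).const_mul (p z.1 z.2))
      (fun η => abs_term_le ha hp hg hC hf η z)
    refine h1.trans (le_of_eq ?_)
    rw [integral_const_mul, integral_const_mul, integral_mul_const,
      integral_eval ha.pos ha.summable μ hμ z.1 (fun n => (n : ℝ))]
    ring

include ha hg hC hμ hf in
/-- Under the product condition, the mean of the pair part of the generator is a difference. -/
theorem exists_integral_pairGen_eq (hC0 : 0 ≤ C) {r : ℕ → ℝ}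
    (hr : ∀ k j, 1 ≤ k → g k (j + k) * μ.real {j + k} = r k * μ.real {j}) :
    ∃ H : X → ℝ, Summable H ∧
      ∀ x y, ∫ η, pairGen g x y f η ∂(configMeasure a μ) = H y - H x := by
  have := isProbabilityMeasure_configMeasure ha.pos ha.summable μ hμ
  -- Summing `hr` over j identifies `r k` as the mean of the k-jump rate, which supplies its sign
  -- and the summability of k r_k.
  have hr' : ∀ k, 1 ≤ k → ∫ n, g k n ∂μ = r k := fun k hk => by
    have h1 : ∫ n, g k n ∂μ = ∑' n, μ.real {n} * g k n :=
      integral_countable (integrable_rate hg hC μ hμ hC0 k)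
    have h2 : ∫ _ : ℕ, r k ∂μ = ∑' n, μ.real {n} * r k := integral_countable (integrable_const _)
    rw [h1, ← Function.Injective.tsum_eq (add_left_injective k)]
    · rw [tsum_congr fun j => show μ.real {j + k} * g k (j + k) = μ.real {j} * r k by
        rw [mul_comm, hr k j hk, mul_comm], ← h2]
      simp
    · intro n hn
      by_contra h
      apply hn
      have hnk : n < k := by
        by_contra h'
        exact h ⟨n - k, Nat.sub_add_cancel (not_lt.1 h')⟩
      simp [rate_eq_zero hg hnk]
  set ρ : ℕ → ℝ := fun k => ∫ n, g k n ∂μ with hρ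
  have hρ0 : ∀ k, 0 ≤ ρ k := fun k => integral_nonneg fun n => rate_nonneg hg k n
  have hρs : Summable fun k : ℕ => (k : ℝ) * ρ k := summable_mul_integral_rate hg hC μ hμ hC0
  set D : ℕ → X → ℝ := fun k x => ∫ η, (f (Config.addAt x k η) - f η) ∂(configMeasure a μ) with hD
  have hint : ∀ x k, Integrable (fun η => f (Config.addAt x k η) - f η) (configMeasure a μ) :=
    fun x k => Integrable.of_bound
      ((hf.measurable.comp (measurable_addAt x k)).sub hf.measurable).aestronglyMeasurable (K * (k * a x))
      (Eventually.of_forall fun η => hf.abs_addAt_sub_le ha.pos x k η)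
  have hDle : ∀ k x, |D k x| ≤ K * (k * a x) := fun k x => by
    have h := norm_integral_le_of_norm_le_const (μ := configMeasure a μ) (C := K * (k * a x))
      (f := fun η => f (Config.addAt x k η) - f η) (Eventually.of_forall fun η => hf.abs_addAt_sub_le ha.pos x k η)
    simpa using h
  have hbd : ∀ x k, ‖ρ k * D k x‖ ≤ ((k : ℝ) * ρ k) * (K * a x) := fun x k => by
    rw [norm_mul, Real.norm_eq_abs, Real.norm_eq_abs, abs_of_nonneg (hρ0 k)]
    exact (mul_le_mul_of_nonneg_left (hDle k x) (hρ0 k)).trans (le_of_eq (by ring))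
  have hsum : ∀ x, Summable fun k => ρ k * D k x := fun x =>
    Summable.of_norm_bounded (hρs.mul_right _) (hbd x)
  refine ⟨fun x => ∑' k, ρ k * D k x, ?_, fun x y => ?_⟩
  · refine Summable.of_norm_bounded ((ha.summable.mul_left K).mul_left (∑' k : ℕ, (k : ℝ) * ρ k))
      fun x => ?_
    exact tsum_of_norm_bounded (hρs.hasSum.mul_right (K * a x)) (hbd x)
  · rcases eq_or_ne x y with rfl | hxy
    · simp [pairGen_self]
    have hab : 0 ≤ a x + a y := add_nonneg (ha.pos x).le (ha.pos y).le
    have hterm : ∀ k (η : Config a), ‖g k (η.1 x) * (f (Config.jump x y k η) - f η)‖ ≤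
        g k (η.1 x) * (K * (k * (a x + a y))) := fun k η => by
      rw [norm_mul, Real.norm_eq_abs, Real.norm_eq_abs, abs_of_nonneg (rate_nonneg hg _ _)]
      exact mul_le_mul_of_nonneg_left (hf.abs_jump_sub_le ha.pos x y k η) (rate_nonneg hg _ _)
    have hgi : ∀ k, Integrable (fun η : Config a => g k (η.1 x)) (configMeasure a μ) := fun k =>
      integrable_eval ha.pos ha.summable μ hμ x (integrable_rate hg hC μ hμ hC0 k)
    have hjm : ∀ k, Measurable fun η : Config a => f (Config.jump x y k η) - f η := fun k =>
      (hf.measurable.comp (measurable_jump x y k)).sub hf.measurable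
    have hti : ∀ k, Integrable (fun η : Config a => g k (η.1 x) *
        (f (Config.jump x y k η) - f η)) (configMeasure a μ) := fun k =>
      (hgi k).mul_bdd (c := K * (k * (a x + a y))) (hjm k).aestronglyMeasurable
        (Eventually.of_forall fun η => hf.abs_jump_sub_le ha.pos x y k η)
    have h := hasSum_integral_of_summable_integral_norm hti (Summable.of_nonneg_of_le
      (fun k => integral_nonneg fun η => norm_nonneg _) (fun k => ?_)
      (hρs.mul_right (K * (a x + a y))))
    · simp_rw [(hasSum_pairGen hg f x y _).tsum_eq] at h
      refine h.unique (((hsum y).hasSum.sub (hsum x).hasSum).congr_fun fun k => ?_)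
      rcases Nat.eq_zero_or_pos k with rfl | hk
      · have h0 : ∀ n, g 0 n = 0 := fun n => hg.zero n 0
        simp [h0, hρ]
      -- The rate is traded for k extra particles at x. Jumping from there puts them at y instead,
      -- so f(η + k at y) - f(η + k at x) remains.
      rw [integral_weight_mul ha.pos ha.summable μ hμ x (integrable_rate hg hC μ hμ hC0 k)
        (fun n hn => rate_eq_zero hg hn) (fun j => hr k j hk) (hjm k)
        (fun η => hf.abs_jump_sub_le ha.pos x y k η), ← hr' k hk]
      rw [← mul_sub, hD]
      simp only
      rw [← integral_sub (hint y k) (hint x k)]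
      congr 1
      refine integral_congr_ae (Eventually.of_forall fun η => ?_)
      simp only [Config.jump_addAt hxy]
      ring
    · refine (integral_mono (hti k).norm ((hgi k).mul_const _) (hterm k)).trans (le_of_eq ?_)
      rw [integral_mul_const, integral_eval ha.pos ha.summable μ hμ x (g k)]
      simp only [hρ]
      ring

include ha hp hg hC hμ hf in
-- The pair means are H y - H x, and unit row and column sums of p make both halves sum to the same
-- ∑ H.
theorem hasSum_integral_pairGen_zero (hcol : ∀ y, HasSum (fun x => p x y) 1) (hC0 : 0 ≤ C)
    {r : ℕ → ℝ} (hr : ∀ k j, 1 ≤ k → g k (j + k) * μ.real {j + k} = r k * μ.real {j}) :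
    HasSum (fun z : X × X => p z.1 z.2 * ∫ η, pairGen g z.1 z.2 f η ∂(configMeasure a μ)) 0 := by
  obtain ⟨H, hH, h⟩ := exists_integral_pairGen_eq ha hg hC μ hμ hf hC0 hr
  have := (hasSum_prod_snd hp.nonneg hcol hH).sub (hasSum_prod_fst hp.nonneg hp.hasSum_one hH)
  rw [sub_self] at this
  exact this.congr_fun fun z => by rw [h]; ring

end Integral

/-- At j = 0 the identity holds trivially because μ(0) > 0, so the condition extends from α ≥ 1 to
all j. -/
theorem ProductCondition.shift {g : ℕ → ℕ → ℝ} {μ : Measure ℕ} (h : ProductCondition g μ)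
    (h0 : 0 < μ.real {0}) (k j : ℕ) (hk : 1 ≤ k) :
    g k (j + k) * μ.real {j + k} = μ.real {k} / μ.real {0} * g k k * μ.real {j} := by
  rcases Nat.eq_zero_or_pos j with rfl | hj
  · rw [zero_add]; field_simp
  · rw [h k j hk hj]; ring

theorem IsLipConst.mono (ha : ∀ x, 0 < a x) {f : Config a → ℝ} {K K' : ℝ} (hf : IsLipConst f K)
    (h : K ≤ K') : IsLipConst f K' :=
  ⟨hf.1.trans h, fun η ζ => (hf.2 η ζ).trans
    (mul_le_mul_of_nonneg_right h (distance_nonneg ha η ζ))⟩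

/-! ### Differentiation of the semigroup -/

section Semigroup

variable [DecidableEq X] {p : X → X → ℝ} {g : ℕ → ℕ → ℝ} {C M : ℝ}
  (ha : IsWeight p a) (hp : IsIrreducibleTransition p)
  (hM : ∀ x, ∑' y, p x y * a y ≤ M * a x) (hg : IsRate (zeroRangeRate g))
  (hC : ∀ n : ℕ, ∑ k ∈ Finset.Icc 1 n, (k : ℝ) * g k n ≤ C * n)
  {S : ℝ≥0 → (Lip a →ₗ[ℝ] Lip a)} (hS : IsMarkovSemigroup p (zeroRangeRate g) S)

include ha hS in
theorem IsMarkovSemigroup.exists_lipConst (f : Lip a) :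
    ∃ B : ℝ → ℝ, ∀ T s : ℝ, s ≤ T → IsLipConst (S s.toNNReal f).1 (B T) := by
  obtain ⟨c, hc⟩ := hS.lipschitz
  obtain ⟨K, hK⟩ := f.2
  -- The constant `c` may be negative and negative times are truncated to 0; `|c|` and `max T 0`
  -- give one bound for all s ≤ T.
  refine ⟨fun T => K * Real.exp (|c| * max T 0), fun T s hs => ?_⟩
  refine (hc s.toNNReal f K hK).mono ha.pos ?_
  refine mul_le_mul_of_nonneg_left (Real.exp_le_exp.2 ?_) hK.1
  rw [Real.coe_toNNReal']
  exact mul_le_mul (le_abs_self c) (max_le_max_right 0 hs) (le_max_right _ _) (abs_nonneg c)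

include hS in
theorem IsMarkovSemigroup.intervalIntegrable (f : Lip a) (η : Config a) (t : ℝ) :
    IntervalIntegrable (fun s : ℝ => generator p (zeroRangeRate g) (S s.toNNReal f).1 η)
      volume 0 t := by
  rcases le_total 0 t with ht | ht
  · simpa [ht] using (hS.kolmogorov t.toNNReal f η).1
  · have h : IntervalIntegrable (fun _ : ℝ => generator p (zeroRangeRate g) (S 0 f).1 η)
        volume 0 t := intervalIntegrable_const
    refine h.congr fun s hs => ?_
    rw [Set.uIoc_of_ge ht] at hs
    simp only [Real.toNNReal_of_nonpos hs.2]

include hS in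
theorem IsMarkovSemigroup.continuous_apply (f : Lip a) (η : Config a) :
    Continuous fun s : ℝ => (S s.toNNReal f).1 η := by
  have hi := hS.intervalIntegrable f η
  have h1 : Continuous fun t => ∫ s in (0 : ℝ)..t,
      generator p (zeroRangeRate g) (S s.toNNReal f).1 η :=
    intervalIntegral.continuous_primitive (fun u v => (hi u).symm.trans (hi v)) 0
  have h2 : (fun s : ℝ => (S s.toNNReal f).1 η) = fun s => f.1 η + ∫ r in (0 : ℝ)..(max s 0),
      generator p (zeroRangeRate g) (S r.toNNReal f).1 η := by
    funext s
    rw [← Real.coe_toNNReal']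
    exact (hS.kolmogorov s.toNNReal f η).2
  rw [h2]
  exact continuous_const.add (h1.comp (continuous_id.max continuous_const))

include ha hp hM hg hC hS in
-- On s ≤ T the functions S(s) f share a Lipschitz constant, so the generator is a series of
-- continuous functions of s with a summable bound.
theorem IsMarkovSemigroup.continuous_generator (f : Lip a) (η : Config a) :
    Continuous fun s : ℝ => generator p (zeroRangeRate g) (S s.toNNReal f).1 η := by
  obtain ⟨B, hB⟩ := hS.exists_lipConst ha f
  rw [continuous_iff_continuousAt]
  intro s
  have h : ContinuousOn (fun s : ℝ => generator p (zeroRangeRate g) (S s.toNNReal f).1 η)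
      (Set.Iic (s + 1)) := by
    simp_rw [generator_zeroRange]
    refine continuousOn_tsum (fun z => Continuous.continuousOn ?_)
      (ha.summable_bound hp hM η (B (s + 1) * C))
      fun z r hr => abs_term_le ha hp hg hC (hB (s + 1) r hr) η z
    unfold pairGen
    refine continuous_const.mul (continuous_finsetSum _ fun k _ => continuous_const.mul ?_)
    exact (hS.continuous_apply f _).sub (hS.continuous_apply f _)
  exact h.continuousAt (Iic_mem_nhds (by linarith))

include ha hp hM hg hC hS in
-- Since `Real.toNNReal` freezes the semigroup at negative times, the term with `min s 0` prolongs
-- it linearly with slope equal to the generator of f. Two-sided derivatives then exist also at 0,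
-- and the term vanishes for s ≥ 0.
theorem IsMarkovSemigroup.hasDerivAt_apply (f : Lip a) (η : Config a) (s : ℝ) :
    HasDerivAt (fun s : ℝ => (S s.toNNReal f).1 η +
        min s 0 * generator p (zeroRangeRate g) f.1 η)
      (generator p (zeroRangeRate g) (S s.toNNReal f).1 η) s := by
  have hc := hS.continuous_generator ha hp hM hg hC f η
  have h := (hc.integral_hasStrictDerivAt 0 s).hasDerivAt.const_add (f.1 η)
  refine h.congr_of_eventuallyEq (Eventually.of_forall fun t => ?_)
  rcases le_total 0 t with ht | ht
  · have := (hS.kolmogorov t.toNNReal f η).2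
    rw [Real.coe_toNNReal _ ht] at this
    simp [this, min_eq_right ht]
  · have h0 : S 0 f = f := by rw [hS.zero]; rfl
    have h1 : ∫ s in (0 : ℝ)..t, generator p (zeroRangeRate g) (S s.toNNReal f).1 η =
        ∫ _ in (0 : ℝ)..t, generator p (zeroRangeRate g) f.1 η := by
      refine intervalIntegral.integral_congr fun r hr => ?_
      rw [Set.uIcc_of_ge ht] at hr
      simp only [Real.toNNReal_of_nonpos hr.2, h0]
    simp only [h1]
    simp [Real.toNNReal_of_nonpos ht, min_eq_left ht, h0]

variable [Countable X] (μ : Measure ℕ) [IsProbabilityMeasure μ]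
  (hμ : Integrable (fun n : ℕ => (n : ℝ)) μ)

include ha hp hM hg hC hS hμ in
-- Differentiation under the integral: up to time s + 1 the derivative is dominated by a multiple of
-- the norm ‖η‖, which is integrable.
theorem IsMarkovSemigroup.hasDerivAt_integral (hC0 : 0 ≤ C) (f : Lip a) (s : ℝ) :
    HasDerivAt (fun s : ℝ => ∫ η, ((S s.toNNReal f).1 η +
        min s 0 * generator p (zeroRangeRate g) f.1 η) ∂(configMeasure a μ))
      (∫ η, generator p (zeroRangeRate g) (S s.toNNReal f).1 η ∂(configMeasure a μ)) s := by
  obtain ⟨B, hB⟩ := hS.exists_lipConst ha f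
  obtain ⟨K, hK⟩ := f.2
  have hi : ∀ t : ℝ, Integrable (fun η => (S t.toNNReal f).1 η +
        min t 0 * generator p (zeroRangeRate g) f.1 η) (configMeasure a μ) := fun t =>
    ((hB t t le_rfl).integrable ha.pos ha.summable μ hμ).add
      ((integrable_generator ha hp hM hg hC μ hμ hK hC0).const_mul _)
  refine (hasDerivAt_integral_of_dominated_loc_of_deriv_le (Iic_mem_nhds (lt_add_one s))
    (Eventually.of_forall fun t => (hi t).1) (hi s)
    (integrable_generator ha hp hM hg hC μ hμ (hB s s le_rfl) hC0).1
    (bound := fun η => B (s + 1) * C * ((1 + M) * mass η))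
    (Eventually.of_forall fun η t ht => ?_)
    (((integrable_mass ha.pos ha.summable μ hμ).const_mul (1 + M)).const_mul _)
    (Eventually.of_forall fun η t _ => hS.hasDerivAt_apply ha hp hM hg hC f η t)).2
  exact abs_generator_le ha hp hM hC0 hg hC (hB (s + 1) t ht) η

include ha hp hM hg hC hS hμ in
/-- If the generator has mean zero, the measure is invariant. -/
theorem IsMarkovSemigroup.isInvariant (hC0 : 0 ≤ C)
    (h : ∀ (f : Config a → ℝ) (K : ℝ), IsLipConst f K →
      ∫ η, generator p (zeroRangeRate g) f η ∂(configMeasure a μ) = 0) :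
    IsInvariant S (productMeasure X μ) := by
  refine ⟨ae_summable ha.pos ha.summable μ hμ, fun f _ t => ?_⟩
  have hd := hS.hasDerivAt_integral ha hp hM hg hC μ hμ hC0 f
  -- S(s) f is again Lipschitz, so the mean-zero hypothesis applies to it at every time.
  have h0 := is_const_of_deriv_eq_zero (fun s => (hd s).differentiableAt) (fun s => by
    obtain ⟨K, hK⟩ := (S s.toNNReal f).2
    rw [(hd s).deriv, h _ K hK]) t 0
  have hS0 : S 0 f = f := by rw [hS.zero]; rfl
  have h1 : ∫ η, (S t f).1 η ∂(configMeasure a μ) = ∫ η, f.1 η ∂(configMeasure a μ) := by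
    simpa [hS0] using h0
  exact h1

include ha hp hM hg hC hS hμ in
/-- If the measure is invariant, the generator has mean zero. -/
theorem IsMarkovSemigroup.integral_generator_eq_zero (hC0 : 0 ≤ C)
    (h : IsInvariant S (productMeasure X μ)) {f : Config a → ℝ} {K : ℝ} (hf : IsLipConst f K)
    (hb : ∃ B : ℝ, ∀ η, |f η| ≤ B) :
    ∫ η, generator p (zeroRangeRate g) f η ∂(configMeasure a μ) = 0 := by
  have hd := hS.hasDerivAt_integral ha hp hM hg hC μ hμ hC0 ⟨f, K, hf⟩ 0
  have hS0 : S 0 ⟨f, K, hf⟩ = ⟨f, K, hf⟩ := by rw [hS.zero]; rfl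
  rw [Real.toNNReal_zero, hS0] at hd
  -- By invariance the integral is constant on t ≥ 0, so its right derivative at 0, the mean of the
  -- generator, is zero.
  refine (uniqueDiffWithinAt_Ici (0 : ℝ)).eq_deriv _ hd.hasDerivWithinAt
    ((hasDerivWithinAt_const (0 : ℝ) (Set.Ici 0) (∫ η, f η ∂(configMeasure a μ))).congr
      (fun t ht => ?_) ?_)
  · have := h.integral_eq ⟨f, K, hf⟩ hb t.toNNReal
    simp only [min_eq_right (Set.mem_Ici.1 ht), zero_mul, add_zero]
    exact this
  · simp [hS0]

end Semigroup

/-! ### Necessity of the product condition -/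

theorem Config.jump_upd [DecidableEq X] {x x' y' : X} (h1 : x ≠ x') (h2 : x ≠ y') (k n : ℕ)
    (η : Config a) :
    Config.jump x' y' k (Config.upd x n η) = Config.upd x n (Config.jump x' y' k η) := by
  apply Subtype.ext; funext z
  simp only [Config.jump_apply, Config.upd_apply, h1.symm, h2.symm, if_false]
  by_cases hz : z = x
  · subst hz; simp [h1, h2]
  · simp [hz]

/-- A function on `ℕ` with mean zero under `μ`, supported on `{0, n}`. -/
noncomputable def centered (μ : Measure ℕ) (n m : ℕ) : ℝ :=
  if m = n then μ.real {0} else if m = 0 then -μ.real {n} else 0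

theorem integral_ite_eq (μ : Measure ℕ) (n : ℕ) (c : ℝ) :
    ∫ m, (if m = n then c else 0) ∂μ = μ.real {n} * c := by
  have : (fun m : ℕ => if m = n then c else 0) = Set.indicator {n} fun _ => c := by
    funext m; simp [Set.indicator]
  rw [this, integral_indicator_const _ (measurableSet_singleton n), smul_eq_mul]

/-- As k ≥ 1, the argument m + k never reaches 0, and only m = b - k contributes. -/
theorem integral_centered_add (μ : Measure ℕ) {b k : ℕ} (hk : 1 ≤ k) (hkb : k ≤ b) :
    ∫ m, centered μ b (m + k) ∂μ = μ.real {b - k} * μ.real {0} := by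
  rw [← integral_ite_eq]
  congr 1
  funext m
  unfold centered
  by_cases h : m = b - k
  · rw [if_pos h, if_pos (by omega)]
  · rw [if_neg h, if_neg (by omega), if_neg (by omega)]

/-! ### Integrals and regularity of the centered test functions. -/

section Centered

variable (μ : Measure ℕ) [IsProbabilityMeasure μ]

theorem abs_centered_le (n m : ℕ) : |centered μ n m| ≤ 1 := by
  have h : ∀ j, |μ.real {j}| ≤ 1 := fun j => by
    rw [abs_of_nonneg measureReal_nonneg]; exact measureReal_le_one
  unfold centered
  split_ifs
  · exact h 0
  · rw [abs_neg]; exact h n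
  · simp

theorem abs_centered_sub_le (n i j : ℕ) :
    |centered μ n i - centered μ n j| ≤ 2 * |(i : ℝ) - j| := by
  rcases eq_or_ne i j with rfl | h
  · simp
  · have h1 : (1 : ℝ) ≤ |(i : ℝ) - j| := by
      have : (1 : ℤ) ≤ |(i : ℤ) - j| := Int.one_le_abs (by omega)
      exact_mod_cast this
    have h2 := abs_sub (centered μ n i) (centered μ n j)
    have h3 := abs_centered_le μ n i
    have h4 := abs_centered_le μ n j
    linarith

theorem integrable_of_abs_le {w : ℕ → ℝ} {B : ℝ} (h : ∀ n, |w n| ≤ B) : Integrable w μ :=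
  Integrable.of_bound Measurable.of_discrete.aestronglyMeasurable B (Eventually.of_forall h)

theorem integrable_ite_eq (n : ℕ) (c : ℝ) : Integrable (fun m : ℕ => if m = n then c else 0) μ :=
  integrable_of_abs_le μ (B := |c|) fun m => by split_ifs <;> simp

theorem integral_centered {n : ℕ} (hn : 1 ≤ n) : ∫ m, centered μ n m ∂μ = 0 := by
  have h : centered μ n = fun m => (if m = n then μ.real {0} else 0) +
      (if m = 0 then -μ.real {n} else 0) := by
    funext m
    unfold centered
    by_cases h1 : m = n
    · have : m ≠ 0 := by omega
      simp [h1, show n ≠ 0 by omega]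
    · simp [h1]
  rw [h, integral_add (integrable_ite_eq μ _ _) (integrable_ite_eq μ _ _), integral_ite_eq,
    integral_ite_eq]
  ring

/-- The rate vanishes for m < k, so truncated subtraction does no harm: m - k lies in {0, n} only
for m = k and m = n + k. -/
theorem integral_rate_mul_centered {g : ℕ → ℕ → ℝ} (hg : IsRate (zeroRangeRate g)) {n k : ℕ}
    (hn : 1 ≤ n) :
    ∫ m, g k m * centered μ n (m - k) ∂μ =
      μ.real {0} * g k (n + k) * μ.real {n + k} - μ.real {n} * μ.real {k} * g k k := by
  have h : (fun m => g k m * centered μ n (m - k)) =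
      fun m => (if m = n + k then g k (n + k) * μ.real {0} else 0) +
        (if m = k then g k k * -μ.real {n} else 0) := by
    funext m
    unfold centered
    rcases lt_or_ge m k with h | h
    · rw [rate_eq_zero hg h]
      simp [show m ≠ n + k by omega, show m ≠ k by omega]
    · obtain ⟨j, rfl⟩ := Nat.exists_eq_add_of_le' h
      rw [Nat.add_sub_cancel]
      by_cases h1 : j = n
      · subst h1
        simp [show j ≠ 0 by omega]
      · by_cases h2 : j = 0
        · subst h2
          simp [h1, show n ≠ 0 by omega]
        · simp [h1, h2]
  rw [h, integral_add (integrable_ite_eq μ _ _) (integrable_ite_eq μ _ _), integral_ite_eq,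
    integral_ite_eq]
  ring

theorem isLipConst_centered_mul (ha : ∀ x, 0 < a x) (x y : X) (n b : ℕ) :
    IsLipConst (fun η : Config a => centered μ n (η.1 x) * centered μ b (η.1 y))
      (2 / a x + 2 / a y) := by
  refine ⟨add_nonneg (div_nonneg zero_le_two (ha x).le) (div_nonneg zero_le_two (ha y).le),
    fun η ζ => ?_⟩
  have hd : ∀ z, |(η.1 z : ℝ) - ζ.1 z| ≤ distance η ζ / a z := fun z => by
    rw [le_div_iff₀ (ha z)]; exact mul_le_distance ha η ζ z
  have h1 := (abs_centered_sub_le μ n (η.1 x) (ζ.1 x)).trans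
    (mul_le_mul_of_nonneg_left (hd x) zero_le_two)
  have h2 := (abs_centered_sub_le μ b (η.1 y) (ζ.1 y)).trans
    (mul_le_mul_of_nonneg_left (hd y) zero_le_two)
  have e : centered μ n (η.1 x) * centered μ b (η.1 y) -
      centered μ n (ζ.1 x) * centered μ b (ζ.1 y) =
      (centered μ n (η.1 x) - centered μ n (ζ.1 x)) * centered μ b (η.1 y) +
      centered μ n (ζ.1 x) * (centered μ b (η.1 y) - centered μ b (ζ.1 y)) := by ring
  simp only [e]
  refine (abs_add_le _ _).trans ?_
  rw [abs_mul, abs_mul]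
  have h3 := mul_le_of_le_one_right
    (abs_nonneg (centered μ n (η.1 x) - centered μ n (ζ.1 x))) (abs_centered_le μ b (η.1 y))
  have h4 := mul_le_of_le_one_left
    (abs_nonneg (centered μ b (η.1 y) - centered μ b (ζ.1 y))) (abs_centered_le μ n (ζ.1 x))
  calc _ ≤ 2 * (distance η ζ / a x) + 2 * (distance η ζ / a y) := by linarith
    _ = _ := by ring

end Centered

section Necessity

variable [DecidableEq X] {p : X → X → ℝ} {g : ℕ → ℕ → ℝ} {C M : ℝ}
  (ha : IsWeight p a) (hp : IsIrreducibleTransition p)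
  (hM : ∀ x, ∑' y, p x y * a y ≤ M * a x) (hg : IsRate (zeroRangeRate g))
  (hC : ∀ n : ℕ, ∑ k ∈ Finset.Icc 1 n, (k : ℝ) * g k n ≤ C * n)
  (μ : Measure ℕ) [IsProbabilityMeasure μ] (hμ : Integrable (fun n : ℕ => (n : ℝ)) μ)

variable [Countable X]

include ha hg hC hμ in
/-- Jumps between other sites do not see a centered factor. -/
theorem integral_pairGen_centered_eq_zero {x x' y' : X} (h1 : x ≠ x') (h2 : x ≠ y') {w : ℕ → ℝ}
    (hw : ∫ n, w n ∂μ = 0) {H : Config a → ℝ} (hH : ∀ n η, H (Config.upd x n η) = H η)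
    {K : ℝ} (hf : IsLipConst (fun η : Config a => w (η.1 x) * H η) K) :
    ∫ η, pairGen g x' y' (fun η => w (η.1 x) * H η) η ∂(configMeasure a μ) = 0 := by
  have he : ∀ η, pairGen g x' y' (fun η => w (η.1 x) * H η) η =
      w (η.1 x) * pairGen g x' y' H η := fun η => by
    unfold pairGen
    rw [Finset.mul_sum]
    refine Finset.sum_congr rfl fun k _ => ?_
    have : (Config.jump x' y' k η).1 x = η.1 x := by
      simp [Config.jump_apply, h1, h2]
    simp only [this]
    ring
  have hi := (integrable_pairGen ha hg hC μ hμ hf x' y').congr (Eventually.of_forall he)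
  simp_rw [he]
  rw [integral_mul_of_upd_eq ha.pos ha.summable μ hμ x (fun n η => ?_) hi, hw, zero_mul]
  unfold pairGen
  simp only [Config.jump_upd h1 h2, hH, Config.upd_apply, if_neg h1.symm]

include ha hg hC hμ in
-- The loss term factors into an expectation at x times the mean of v at y, which is zero. In the
-- gain term only jumps of k ≤ b particles survive, since v(η(y) + k) = 0 for larger k; each mean
-- factors by independence.
theorem integral_pairGen_centered (hC0 : 0 ≤ C) {x y : X} (hxy : x ≠ y) {n b : ℕ} (hn : 1 ≤ n)
    (hb : 1 ≤ b) :
    ∫ η, pairGen g x y (fun η : Config a => centered μ n (η.1 x) * centered μ b (η.1 y)) η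
        ∂(configMeasure a μ) =
      ∑ k ∈ Finset.Icc 1 b, (μ.real {0} * g k (n + k) * μ.real {n + k} -
        μ.real {n} * μ.real {k} * g k k) * (μ.real {b - k} * μ.real {0}) := by
  set u := centered μ n with hu
  set v := centered μ b with hv
  set G : ℕ → ℝ := fun m => ∑ k ∈ Finset.Icc 1 m, g k m with hG
  have he : ∀ η : Config a, pairGen g x y (fun η => u (η.1 x) * v (η.1 y)) η =
      (∑ k ∈ Finset.Icc 1 b, v (η.1 y + k) * (g k (η.1 x) * u (η.1 x - k))) -
        v (η.1 y) * (G (η.1 x) * u (η.1 x)) := fun η => by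
    have e1 : pairGen g x y (fun η => u (η.1 x) * v (η.1 y)) η =
        ∑ k ∈ Finset.Icc 1 (η.1 x), (v (η.1 y + k) * (g k (η.1 x) * u (η.1 x - k)) -
          g k (η.1 x) * (v (η.1 y) * u (η.1 x))) := by
      unfold pairGen
      refine Finset.sum_congr rfl fun k hk => ?_
      have hk' : ¬ (x = y ∨ η.1 x < k) := by
        rw [Finset.mem_Icc] at hk; push Not; exact ⟨hxy, hk.2⟩
      have j1 : (Config.jump x y k η).1 x = η.1 x - k := by
        rw [Config.jump_apply, if_neg hk', if_pos rfl]
      have j2 : (Config.jump x y k η).1 y = η.1 y + k := by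
        rw [Config.jump_apply, if_neg hk', if_neg hxy.symm, if_pos rfl]
      simp only [j1, j2]
      ring
    rw [e1, Finset.sum_sub_distrib, ← Finset.sum_mul, hG]
    congr 1
    -- The sums up to η(x) and up to b agree, because both reduce to k ≤ min(b, η(x)); beyond b the
    -- factor v vanishes, and beyond η(x) the rate does.
    · have hz : ∀ k, ¬ (1 ≤ k → k ≤ b ∧ k ≤ η.1 x) →
          v (η.1 y + k) * (g k (η.1 x) * u (η.1 x - k)) = 0 := fun k hk => by
        push Not at hk
        by_cases h : k ≤ b
        · rw [rate_eq_zero hg (hk.2 h)]; ring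
        · have : v (η.1 y + k) = 0 := by
            rw [hv, centered, if_neg (by omega), if_neg (by omega)]
          rw [this, zero_mul]
      rw [← Finset.sum_subset (s₁ := Finset.Icc 1 (min b (η.1 x))) (s₂ := Finset.Icc 1 (η.1 x)),
        ← Finset.sum_subset (s₁ := Finset.Icc 1 (min b (η.1 x))) (s₂ := Finset.Icc 1 b)]
      · exact Finset.Icc_subset_Icc_right (min_le_left _ _)
      · intro k hk hk'
        simp only [Finset.mem_Icc, le_min_iff] at hk hk'
        exact hz k fun h => hk' ⟨hk.1, h hk.1⟩
      · exact Finset.Icc_subset_Icc_right (min_le_right _ _)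
      · intro k hk hk'
        simp only [Finset.mem_Icc, le_min_iff] at hk hk'
        exact hz k fun h => hk' ⟨hk.1, h hk.1⟩
    · ring
  have hGle : ∀ m, |G m * u m| ≤ C * m := fun m => by
    have h0 : 0 ≤ G m := Finset.sum_nonneg fun k _ => rate_nonneg hg k m
    rw [abs_mul, abs_of_nonneg h0]
    refine (mul_le_of_le_one_right h0 (abs_centered_le μ n m)).trans (le_trans ?_ (hC m))
    refine Finset.sum_le_sum fun k hk => le_mul_of_one_le_left (rate_nonneg hg k m) ?_
    exact_mod_cast (Finset.mem_Icc.1 hk).1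
  have hGi : Integrable (fun m => G m * u m) μ :=
    Integrable.mono' (hμ.const_mul C) Measurable.of_discrete.aestronglyMeasurable
      (Eventually.of_forall hGle)
  have hgi : ∀ k, Integrable (fun m => g k m * u (m - k)) μ := fun k =>
    (integrable_rate hg hC μ hμ hC0 k).mul_bdd (c := 1) Measurable.of_discrete.aestronglyMeasurable
      (Eventually.of_forall fun m => abs_centered_le μ n (m - k))
  have hvm : ∀ k, Measurable fun η : Config a => v (η.1 y + k) := fun k => by
    have h : Measurable fun m => v (m + k) := Measurable.of_discrete
    exact h.comp (measurable_eval y)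
  have hprod : ∀ (k : ℕ) (w : ℕ → ℝ), Integrable w μ →
      Integrable (fun η : Config a => v (η.1 y + k) * w (η.1 x)) (configMeasure a μ) ∧
      ∫ η : Config a, v (η.1 y + k) * w (η.1 x) ∂(configMeasure a μ) =
        (∫ m, v (m + k) ∂μ) * ∫ m, w m ∂μ := fun k w hw => by
    have hi : Integrable (fun η : Config a => v (η.1 y + k) * w (η.1 x)) (configMeasure a μ) :=
      (integrable_eval ha.pos ha.summable μ hμ x hw).bdd_mul (c := 1) (hvm k).aestronglyMeasurable
        (Eventually.of_forall fun η => abs_centered_le μ b _)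
    refine ⟨hi, ?_⟩
    rw [integral_mul_of_upd_eq ha.pos ha.summable μ hμ y (w := fun m => v (m + k))
      (H := fun η => w (η.1 x)) (fun m η => by simp only [Config.upd_apply, if_neg hxy]) hi,
      integral_eval ha.pos ha.summable μ hμ x w]
  have h0 := hprod 0 _ hGi
  simp only [add_zero] at h0
  simp_rw [he]
  rw [integral_sub (integrable_finsetSum _ fun k _ => (hprod k _ (hgi k)).1) h0.1,
    integral_finsetSum _ fun k _ => (hprod k _ (hgi k)).1]
  rw [h0.2, hv, integral_centered μ hb, zero_mul, sub_zero]
  refine Finset.sum_congr rfl fun k hk => ?_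
  rw [Finset.mem_Icc] at hk
  rw [(hprod k _ (hgi k)).2, hu, integral_rate_mul_centered μ hg hn, hv,
    integral_centered_add μ hk.1 hk.2]
  ring

include ha hp hM hg hC hμ in
-- Testing with centered products at one pair where p is asymmetric leaves a linear system in T(n,b)
-- and T(b,n). Asymmetry makes it nonsingular, and T is triangular in the defects of the condition.
theorem productCondition_of_integral_generator (hC0 : 0 ≤ C) (h0 : 0 < μ.real {0})
    (hsym : ¬ IsSymmetric p)
    (h : ∀ (f : Config a → ℝ) (K : ℝ), IsLipConst f K → (∃ B : ℝ, ∀ η, |f η| ≤ B) →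
      ∫ η, generator p (zeroRangeRate g) f η ∂(configMeasure a μ) = 0) :
    ProductCondition g μ := by
  obtain ⟨x, y, hpxy⟩ : ∃ x y, p x y ≠ p y x := by
    unfold IsSymmetric at hsym; push Not at hsym; exact hsym
  have hxy : x ≠ y := fun e => hpxy (by rw [e])
  set T : ℕ → ℕ → ℝ := fun n b => ∑ k ∈ Finset.Icc 1 b,
    (μ.real {0} * g k (n + k) * μ.real {n + k} - μ.real {n} * μ.real {k} * g k k) *
      (μ.real {b - k} * μ.real {0}) with hT
  have key : ∀ n b, 1 ≤ n → 1 ≤ b → p x y * T n b + p y x * T b n = 0 := fun n b hn hb => by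
    set f : Config a → ℝ := fun η => centered μ n (η.1 x) * centered μ b (η.1 y) with hfdef
    have hfc : f = fun η => centered μ b (η.1 y) * centered μ n (η.1 x) := by
      funext η; exact mul_comm _ _
    have hf : IsLipConst f (2 / a x + 2 / a y) := isLipConst_centered_mul μ ha.pos x y n b
    have hs := hasSum_integral_generator ha hp hM hg hC μ hμ hf
    rw [h f _ hf ⟨1, fun η => by
      rw [hfdef, abs_mul]
      exact mul_le_one₀ (abs_centered_le μ n _) (abs_nonneg _) (abs_centered_le μ b _)⟩] at hs
    have hne : ((x, y) : X × X) ≠ (y, x) := fun e => hxy (Prod.ext_iff.1 e).1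
    have hs' := hasSum_sum_of_ne_finset_zero (L := SummationFilter.unconditional _)
      (f := fun z : X × X => p z.1 z.2 * ∫ η, pairGen g z.1 z.2 f η ∂(configMeasure a μ))
      (s := {(x, y), (y, x)}) (fun z hz => by
        obtain ⟨x', y'⟩ := z
        simp only [Finset.mem_insert, Finset.mem_singleton, Prod.mk.injEq] at hz
        simp only
        rcases eq_or_ne x' y' with rfl | hx'y'
        · simp [pairGen_self]
        -- A jump between distinct sites other than x → y and y → x misses at least one of x and y,
        -- hence leaves one centered factor unchanged.
        have hcase : (x ≠ x' ∧ x ≠ y') ∨ (y ≠ x' ∧ y ≠ y') := by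
          by_contra hcon
          simp only [not_or, not_and_or, not_not] at hcon hz
          rcases hcon with ⟨h1 | h1, h2 | h2⟩ <;> subst h1 <;> subst h2 <;> simp_all
        rcases hcase with ⟨h1, h2⟩ | ⟨h1, h2⟩
        · rw [integral_pairGen_centered_eq_zero ha hg hC μ hμ h1 h2 (integral_centered μ hn)
            (H := fun η => centered μ b (η.1 y))
            (fun m η => by simp only [Config.upd_apply, if_neg hxy.symm]) hf, mul_zero]
        · rw [hfc] at hf ⊢
          rw [integral_pairGen_centered_eq_zero ha hg hC μ hμ h1 h2 (integral_centered μ hb)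
            (H := fun η => centered μ n (η.1 x))
            (fun m η => by simp only [Config.upd_apply, if_neg hxy]) hf, mul_zero])
    have hsum := hs'.unique hs
    rw [Finset.sum_pair hne] at hsum
    simp only at hsum
    rw [integral_pairGen_centered ha hg hC μ hμ hC0 hxy hn hb, hfc,
      integral_pairGen_centered ha hg hC μ hμ hC0 hxy.symm hb hn] at hsum
    exact hsum
  have hT0 : ∀ n b, 1 ≤ n → 1 ≤ b → T n b = 0 := fun n b hn hb => by
    have h1 := key n b hn hb
    have h2 := key b n hb hn
    have hsumpos : 0 < p x y + p y x := by
      rcases (hp.nonneg x y).lt_or_eq with h | h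
      · linarith [hp.nonneg y x]
      · rcases (hp.nonneg y x).lt_or_eq with h' | h'
        · linarith
        · exact absurd (h.symm.trans h') hpxy
    -- Elimination of T(b,n) leaves the determinant p(x,y)² - p(y,x)²; its second factor is positive
    -- because p is nonnegative and its values differ.
    have h3 : (p x y - p y x) * ((p x y + p y x) * T n b) = 0 := by linear_combination p x y * h1 - p y x * h2
    exact (mul_eq_zero.1 ((mul_eq_zero.1 h3).resolve_left (sub_ne_zero.2 hpxy))).resolve_left
      hsumpos.ne'
  intro k α hk hα
  -- In T(α, k) = 0 the defects of smaller index vanish by induction, and the k-th one has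
  -- coefficient μ(0)² > 0.
  have hD : ∀ k, 1 ≤ k → μ.real {0} * g k (α + k) * μ.real {α + k} -
      μ.real {α} * μ.real {k} * g k k = 0 := by
    intro k
    induction k using Nat.strong_induction_on with
    | _ k ih =>
      intro hk
      have := hT0 α k hα hk
      rw [hT] at this
      simp only at this
      rw [Finset.sum_eq_single_of_mem k (Finset.mem_Icc.2 ⟨hk, le_rfl⟩)] at this
      · rw [Nat.sub_self] at this
        exact (mul_eq_zero.1 this).resolve_right (mul_pos h0 h0).ne'
      · intro j hj hjk
        rw [Finset.mem_Icc] at hj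
        rw [ih j (lt_of_le_of_ne hj.2 hjk) hj.1, zero_mul]
  have := hD k hk
  field_simp
  linarith

end Necessity

/-! ### Uniformized exponentials -/

section Exponential

variable {E : Type*} [NormedAddCommGroup E] [NormedSpace ℝ E]

/-- The semigroup `exp (t (Q - l))`. -/
noncomputable def expSemigroup (Q : E →L[ℝ] E) (l t : ℝ) : E →L[ℝ] E :=
  NormedSpace.exp (t • (Q - l • (1 : E →L[ℝ] E)))

theorem expSemigroup_zero (Q : E →L[ℝ] E) (l : ℝ) : expSemigroup Q l 0 = 1 := by
  simp [expSemigroup, NormedSpace.exp_zero]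

variable [CompleteSpace E] (Q : E →L[ℝ] E) (l : ℝ)

theorem expSemigroup_add (s t : ℝ) :
    expSemigroup Q l (s + t) = expSemigroup Q l s * expSemigroup Q l t := by
  let _ : NormedAlgebra ℚ (E →L[ℝ] E) := NormedAlgebra.restrictScalars ℚ ℝ _
  unfold expSemigroup
  rw [add_smul]
  exact NormedSpace.exp_add_of_commute ((Commute.refl _).smul_left s |>.smul_right t)

theorem hasDerivAt_expSemigroup (t : ℝ) :
    HasDerivAt (expSemigroup Q l) (expSemigroup Q l t * (Q - l • 1)) t :=
  hasDerivAt_exp_smul_const (𝔸 := E →L[ℝ] E) (Q - l • 1) t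

theorem hasDerivAt_expSemigroup' (t : ℝ) :
    HasDerivAt (expSemigroup Q l) ((Q - l • 1) * expSemigroup Q l t) t :=
  hasDerivAt_exp_smul_const' (𝔸 := E →L[ℝ] E) (Q - l • 1) t

theorem expSemigroup_eq (t : ℝ) :
    expSemigroup Q l t = Real.exp (-(l * t)) • NormedSpace.exp (t • Q) := by
  let _ : NormedAlgebra ℚ (E →L[ℝ] E) := NormedAlgebra.restrictScalars ℚ ℝ _
  have h : t • (Q - l • (1 : E →L[ℝ] E)) = (algebraMap ℝ (E →L[ℝ] E)) (-(l * t)) + t • Q := by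
    rw [Algebra.algebraMap_eq_smul_one]
    module
  rw [expSemigroup, h, NormedSpace.exp_add_of_commute (Algebra.commutes _ _),
    ← NormedSpace.algebraMap_exp_comm, Algebra.algebraMap_eq_smul_one, smul_mul_assoc, one_mul,
    Real.exp_eq_exp_ℝ]

/-- Uniformization: for t ≥ 0 the coefficients are nonnegative, so signs and bounds for the powers
of Q pass to the semigroup term by term. -/
theorem hasSum_expSemigroup (φ : E →L[ℝ] ℝ) (u : E) (t : ℝ) :
    HasSum (fun m : ℕ => Real.exp (-(l * t)) * (t ^ m / m.factorial * φ ((Q ^ m) u)))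
      (φ (expSemigroup Q l t u)) := by
  have h := NormedSpace.exp_series_hasSum_exp' (𝕂 := ℝ) (t • Q)
  have h1 := (h.mapL ((ContinuousLinearMap.apply ℝ E u))).mapL φ
  rw [expSemigroup_eq]
  simp only [smul_apply, map_smul, smul_eq_mul]
  refine HasSum.mul_left _ (h1.congr_fun fun m => ?_)
  simp only [ContinuousLinearMap.apply_apply, smul_pow, map_smul,
    smul_eq_mul]
  rw [div_eq_mul_inv]; ring

theorem hasSum_exp_mul (r l t A : ℝ) :
    HasSum (fun m : ℕ => Real.exp (-(l * t)) * (t ^ m / m.factorial * (A * r ^ m)))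
      (A * Real.exp ((r - l) * t)) := by
  have h := (NormedSpace.expSeries_div_hasSum_exp (r * t)).mul_left (Real.exp (-(l * t)) * A)
  rw [← Real.exp_eq_exp_ℝ] at h
  have e : A * Real.exp ((r - l) * t) = Real.exp (-(l * t)) * A * Real.exp (r * t) := by
    rw [show (r - l) * t = -(l * t) + r * t by ring, Real.exp_add]; ring
  rw [e]
  exact h.congr_fun fun m => by rw [mul_pow]; ring

variable {Q l}

theorem abs_expSemigroup_le (φ : E →L[ℝ] ℝ) {u : E} {A r t : ℝ} (ht : 0 ≤ t)
    (h : ∀ m : ℕ, |φ ((Q ^ m) u)| ≤ A * r ^ m) :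
    |φ (expSemigroup Q l t u)| ≤ A * Real.exp ((r - l) * t) := by
  have h1 := hasSum_expSemigroup Q l φ u t
  have h2 := hasSum_exp_mul r l t A
  rw [← h1.tsum_eq, ← Real.norm_eq_abs]
  refine tsum_of_norm_bounded h2 fun m => ?_
  have h3 : 0 ≤ t ^ m / m.factorial := div_nonneg (pow_nonneg ht m) (Nat.cast_nonneg _)
  rw [Real.norm_eq_abs, abs_mul, abs_mul, abs_of_nonneg (Real.exp_pos _).le, abs_of_nonneg h3]
  exact mul_le_mul_of_nonneg_left (mul_le_mul_of_nonneg_left (h m) h3) (Real.exp_pos _).le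

theorem expSemigroup_nonneg (φ : E →L[ℝ] ℝ) {u : E} {t : ℝ} (ht : 0 ≤ t)
    (h : ∀ m : ℕ, 0 ≤ φ ((Q ^ m) u)) : 0 ≤ φ (expSemigroup Q l t u) :=
  (hasSum_expSemigroup Q l φ u t).nonneg fun m => mul_nonneg (Real.exp_pos _).le
    (mul_nonneg (div_nonneg (pow_nonneg ht m) (Nat.cast_nonneg _)) (h m))

theorem expSemigroup_eq_const (φ : E →L[ℝ] ℝ) {u : E} {A t : ℝ}
    (h : ∀ m : ℕ, φ ((Q ^ m) u) = A * l ^ m) : φ (expSemigroup Q l t u) = A := by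
  have h1 := hasSum_expSemigroup Q l φ u t
  simp_rw [h] at h1
  have h2 := hasSum_exp_mul l l t A
  rw [sub_self, zero_mul, Real.exp_zero, mul_one] at h2
  exact h1.unique h2

end Exponential

/-! ### Jump processes with finitely many deterministic jumps -/

section Weighted

variable {Ω ι : Type*} {w : Ω → ℝ}

/-- The value at `η` of the function `w * u`. -/
noncomputable def weightedEval (w : Ω → ℝ) (η : Ω) : lp (fun _ : Ω => ℝ) ∞ →L[ℝ] ℝ :=
  w η • lp.evalCLM ℝ (fun _ : Ω => ℝ) ∞ η

/-- Composition with `σ`, as an operator on functions of growth `w`. -/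
noncomputable def compOp (hw : ∀ η, 1 ≤ w η) (σ : Ω → Ω) (D : ℝ) (hD : ∀ η, w (σ η) ≤ D * w η) :
    lp (fun _ : Ω => ℝ) ∞ →L[ℝ] lp (fun _ : Ω => ℝ) ∞ :=
  have hle : ∀ (u : lp (fun _ : Ω => ℝ) ∞) (η : Ω),
      ‖w (σ η) / w η * u (σ η)‖ ≤ |D| * ‖u‖ := fun u η => by
    have h0 : 0 < w η := zero_lt_one.trans_le (hw η)
    have h1 : 0 ≤ w (σ η) / w η := div_nonneg (zero_le_one.trans (hw _)) h0.le
    rw [norm_mul, Real.norm_eq_abs, abs_of_nonneg h1]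
    refine mul_le_mul ?_ (lp.norm_apply_le_norm ENNReal.top_ne_zero u (σ η)) (norm_nonneg _)
      (abs_nonneg D)
    rw [div_le_iff₀ h0]
    exact (hD η).trans (mul_le_mul_of_nonneg_right (le_abs_self D) h0.le)
  LinearMap.mkContinuous
    -- A bounded u stands for the function w u, so composition with σ acts on u with the factor w(σ
    -- η) / w(η).
    { toFun := fun u => ⟨fun η => w (σ η) / w η * u (σ η), memℓp_infty ⟨|D| * ‖u‖, by
        rintro _ ⟨η, rfl⟩
        exact hle u η⟩⟩
      map_add' := fun u v => by
        ext η
        simp only [lp.coeFn_add, Pi.add_apply]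
        ring
      map_smul' := fun c u => by
        ext η
        simp only [lp.coeFn_smul, Pi.smul_apply, smul_eq_mul, RingHom.id_apply]
        ring }
    |D| fun u => lp.norm_le_of_forall_le (mul_nonneg (abs_nonneg D) (norm_nonneg u)) (hle u)

theorem weightedEval_compOp (hw : ∀ η, 1 ≤ w η) (σ : Ω → Ω) (D : ℝ)
    (hD : ∀ η, w (σ η) ≤ D * w η) (η : Ω) (u : lp (fun _ : Ω => ℝ) ∞) :
    weightedEval w η (compOp hw σ D hD u) = weightedEval w (σ η) u := by
  have h0 : w η ≠ 0 := (zero_lt_one.trans_le (hw η)).ne'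
  change w η * (w (σ η) / w η * u (σ η)) = w (σ η) * u (σ η)
  field_simp

variable (hw : ∀ η, 1 ≤ w η) (σ : ι → Ω → Ω) (D : ι → ℝ) (hD : ∀ i η, w (σ i η) ≤ D i * w η)
  (q : ι → ℝ) (B : Finset ι)

/-- The sum of the composition operators with rates `q i`, `i ∈ B`. -/
noncomputable def jumpOp : lp (fun _ : Ω => ℝ) ∞ →L[ℝ] lp (fun _ : Ω => ℝ) ∞ :=
  ∑ i ∈ B, q i • compOp hw (σ i) (D i) (hD i)

theorem weightedEval_jumpOp (η : Ω) (u : lp (fun _ : Ω => ℝ) ∞) :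
    weightedEval w η (jumpOp hw σ D hD q B u) = ∑ i ∈ B, q i * weightedEval w (σ i η) u := by
  unfold jumpOp
  simp only [sum_apply, smul_apply, map_sum, map_smul,
    weightedEval_compOp, smul_eq_mul]

/-- The semigroup of the process with jumps `η ↦ σ i η` at rate `q i`, `i ∈ B`. -/
noncomputable def jumpSemigroup (t : ℝ) : lp (fun _ : Ω => ℝ) ∞ →L[ℝ] lp (fun _ : Ω => ℝ) ∞ :=
  expSemigroup (jumpOp hw σ D hD q B) (∑ i ∈ B, q i) t

variable {hw σ D hD q B}

theorem weightedEval_jumpOp_sub (η : Ω) (u : lp (fun _ : Ω => ℝ) ∞) :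
    weightedEval w η ((jumpOp hw σ D hD q B - (∑ i ∈ B, q i) • 1) u) =
      ∑ i ∈ B, q i * (weightedEval w (σ i η) u - weightedEval w η u) := by
  rw [sub_apply, map_sub, weightedEval_jumpOp,
    smul_apply, one_apply_eq_self, map_smul, smul_eq_mul,
    Finset.sum_mul, ← Finset.sum_sub_distrib]
  exact Finset.sum_congr rfl fun i _ => by ring

theorem jumpSemigroup_nonneg (hq : ∀ i, 0 ≤ q i) {u : lp (fun _ : Ω => ℝ) ∞}
    (hu : ∀ η, 0 ≤ weightedEval w η u) {t : ℝ} (ht : 0 ≤ t) (η : Ω) :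
    0 ≤ weightedEval w η (jumpSemigroup hw σ D hD q B t u) := by
  refine expSemigroup_nonneg _ ht fun m => ?_
  induction m generalizing η with
  | zero => simpa using hu η
  | succ m ih =>
    rw [pow_succ', mul_apply_eq_comp, weightedEval_jumpOp]
    exact Finset.sum_nonneg fun i _ => mul_nonneg (hq i) (ih _)

theorem jumpSemigroup_const {u : lp (fun _ : Ω => ℝ) ∞} {A : ℝ}
    (hu : ∀ η, weightedEval w η u = A) (t : ℝ) (η : Ω) :
    weightedEval w η (jumpSemigroup hw σ D hD q B t u) = A := by
  refine expSemigroup_eq_const _ fun m => ?_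
  induction m generalizing η with
  | zero => simpa using hu η
  | succ m ih =>
    rw [pow_succ', mul_apply_eq_comp, weightedEval_jumpOp]
    simp_rw [ih]
    rw [← Finset.sum_mul]; ring

theorem abs_jumpSemigroup_le (hq : ∀ i, 0 ≤ q i) {u : lp (fun _ : Ω => ℝ) ∞} {A : ℝ}
    (hu : ∀ η, |weightedEval w η u| ≤ A) {t : ℝ} (ht : 0 ≤ t) (η : Ω) :
    |weightedEval w η (jumpSemigroup hw σ D hD q B t u)| ≤ A := by
  have h : ∀ (m : ℕ) η, |weightedEval w η ((jumpOp hw σ D hD q B ^ m) u)| ≤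
      A * (∑ i ∈ B, q i) ^ m := fun m => by
    induction m with
    | zero => simpa using hu
    | succ m ih =>
      intro η
      rw [pow_succ', mul_apply_eq_comp, weightedEval_jumpOp]
      refine (Finset.abs_sum_le_sum_abs _ _).trans ?_
      calc _ ≤ ∑ i ∈ B, q i * (A * (∑ i ∈ B, q i) ^ m) := Finset.sum_le_sum fun i _ => by
            rw [abs_mul, abs_of_nonneg (hq i)]
            exact mul_le_mul_of_nonneg_left (ih _) (hq i)
        _ = _ := by rw [← Finset.sum_mul]; ring
  have h1 := abs_expSemigroup_le (l := ∑ i ∈ B, q i) (weightedEval w η) ht fun m => h m η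
  rw [sub_self, zero_mul, Real.exp_zero, mul_one] at h1
  exact h1

/-- With l the total rate, each application of the jump operator multiplies the Lipschitz constant
by at most l + c; the factor exp(-l t) leaves exp(c t), independent of the number of jumps. -/
theorem abs_jumpSemigroup_sub_le (hq : ∀ i, 0 ≤ q i) {d : Ω → Ω → ℝ} {c : ℝ} (hc : 0 ≤ c)
    (hd : ∀ η ζ, ∑ i ∈ B, q i * d (σ i η) (σ i ζ) ≤ (∑ i ∈ B, q i + c) * d η ζ)
    {u : lp (fun _ : Ω => ℝ) ∞} {K : ℝ} (hK : 0 ≤ K)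
    (hu : ∀ η ζ, |weightedEval w η u - weightedEval w ζ u| ≤ K * d η ζ) {t : ℝ} (ht : 0 ≤ t)
    (η ζ : Ω) :
    |weightedEval w η (jumpSemigroup hw σ D hD q B t u) -
      weightedEval w ζ (jumpSemigroup hw σ D hD q B t u)| ≤ K * Real.exp (c * t) * d η ζ := by
  have hl : 0 ≤ ∑ i ∈ B, q i := Finset.sum_nonneg fun i _ => hq i
  have h : ∀ (m : ℕ) η ζ, |weightedEval w η ((jumpOp hw σ D hD q B ^ m) u) -
      weightedEval w ζ ((jumpOp hw σ D hD q B ^ m) u)| ≤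
      K * (∑ i ∈ B, q i + c) ^ m * d η ζ := fun m => by
    induction m with
    | zero => simpa using hu
    | succ m ih =>
      intro η ζ
      rw [pow_succ', mul_apply_eq_comp, weightedEval_jumpOp, weightedEval_jumpOp,
        ← Finset.sum_sub_distrib]
      refine (Finset.abs_sum_le_sum_abs _ _).trans ?_
      calc _ ≤ ∑ i ∈ B, K * (∑ i ∈ B, q i + c) ^ m * (q i * d (σ i η) (σ i ζ)) :=
            Finset.sum_le_sum fun i _ => by
              rw [← mul_sub, abs_mul, abs_of_nonneg (hq i)]
              exact (mul_le_mul_of_nonneg_left (ih _ _) (hq i)).trans (le_of_eq (by ring))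
        _ ≤ K * (∑ i ∈ B, q i + c) ^ m * ((∑ i ∈ B, q i + c) * d η ζ) := by
            rw [← Finset.mul_sum]
            exact mul_le_mul_of_nonneg_left (hd η ζ)
              (mul_nonneg hK (pow_nonneg (add_nonneg hl hc) m))
        _ = _ := by ring
  have := abs_expSemigroup_le (l := ∑ i ∈ B, q i) (Q := jumpOp hw σ D hD q B)
    (weightedEval w η - weightedEval w ζ) (u := u) (A := K * d η ζ) (r := ∑ i ∈ B, q i + c) ht
    fun m => (h m η ζ).trans (le_of_eq (by ring))
  refine this.trans (le_of_eq ?_)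
  rw [add_sub_cancel_left]; ring

theorem hasDerivAt_jumpSemigroup (u : lp (fun _ : Ω => ℝ) ∞) (η : Ω) (t : ℝ) :
    HasDerivAt (fun t => weightedEval w η (jumpSemigroup hw σ D hD q B t u))
      (∑ i ∈ B, q i * (weightedEval w (σ i η) (jumpSemigroup hw σ D hD q B t u) -
        weightedEval w η (jumpSemigroup hw σ D hD q B t u))) t := by
  have h := (hasDerivAt_expSemigroup' (jumpOp hw σ D hD q B) (∑ i ∈ B, q i) t).clm_apply
    (hasDerivAt_const t u)
  have h2 := (weightedEval w η).hasFDerivAt.comp_hasDerivAt t h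
  rw [map_zero, add_zero, mul_apply_eq_comp, weightedEval_jumpOp_sub] at h2
  exact h2

/-- Duhamel's formula: the semigroups for `A ⊆ B` are close on Lipschitz functions. -/
theorem abs_jumpSemigroup_sub_jumpSemigroup_le [DecidableEq ι] (hq : ∀ i, 0 ≤ q i) {A : Finset ι}
    (hAB : A ⊆ B) {u : lp (fun _ : Ω => ℝ) ∞} {t : ℝ} (ht : 0 ≤ t) {b : ι → ℝ}
    (hu : ∀ s, 0 ≤ s → s ≤ t → ∀ i η, |weightedEval w (σ i η) (jumpSemigroup hw σ D hD q B s u) -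
        weightedEval w η (jumpSemigroup hw σ D hD q B s u)| ≤ b i) (η : Ω) :
    |weightedEval w η (jumpSemigroup hw σ D hD q B t u) -
      weightedEval w η (jumpSemigroup hw σ D hD q A t u)| ≤ (∑ i ∈ B \ A, q i * b i) * t := by
  set LA := jumpOp hw σ D hD q A - (∑ i ∈ A, q i) • 1 with hLA
  set LB := jumpOp hw σ D hD q B - (∑ i ∈ B, q i) • 1 with hLB
  -- The curve s ↦ S_A(t-s) S_B(s) u joins S_A(t) u to S_B(t) u and has derivative S_A(t-s) (L_B -
  -- L_A) S_B(s) u.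
  have hder : ∀ s, HasDerivAt (fun s => weightedEval w η
      (jumpSemigroup hw σ D hD q A (t - s) (jumpSemigroup hw σ D hD q B s u)))
      (weightedEval w η (jumpSemigroup hw σ D hD q A (t - s)
        ((LB - LA) (jumpSemigroup hw σ D hD q B s u)))) s := fun s => by
    have h1 := (hasDerivAt_expSemigroup (jumpOp hw σ D hD q A) (∑ i ∈ A, q i) (t - s)).scomp s
      ((hasDerivAt_id s).const_sub t)
    have h2 := (hasDerivAt_expSemigroup' (jumpOp hw σ D hD q B) (∑ i ∈ B, q i) s).clm_apply
      (hasDerivAt_const s u)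
    have h3 := (weightedEval w η).hasFDerivAt.comp_hasDerivAt s (h1.clm_apply h2)
    refine h3.congr_deriv ?_
    simp only [map_zero, add_zero, neg_smul, one_smul, mul_apply_eq_comp,
      sub_apply, map_sub, map_add, map_neg, neg_apply, Function.comp]
    simp only [jumpSemigroup, hLA, hLB, map_sub, sub_apply]
    ring
  have hbound : ∀ s ∈ Set.Ico (0 : ℝ) t, ‖weightedEval w η (jumpSemigroup hw σ D hD q A (t - s)
        ((LB - LA) (jumpSemigroup hw σ D hD q B s u)))‖ ≤ ∑ i ∈ B \ A, q i * b i := fun s hs => by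
    refine abs_jumpSemigroup_le hq (fun ζ => ?_) (sub_nonneg.2 hs.2.le) η
    -- Only the jumps in B \ A survive in L_B - L_A, and S_A is a contraction in the supremum norm.
    rw [sub_apply, map_sub, hLA, hLB, weightedEval_jumpOp_sub,
      weightedEval_jumpOp_sub, ← Finset.sum_sdiff hAB, add_sub_cancel_right]
    refine (Finset.abs_sum_le_sum_abs _ _).trans (Finset.sum_le_sum fun i _ => ?_)
    rw [abs_mul, abs_of_nonneg (hq i)]
    exact mul_le_mul_of_nonneg_left (hu s hs.1 hs.2.le i ζ) (hq i)
  have := norm_image_sub_le_of_norm_deriv_le_segment' (fun s _ => (hder s).hasDerivWithinAt)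
    hbound t (Set.right_mem_Icc.2 ht)
  simp only [sub_self, sub_zero] at this
  have e1 : jumpSemigroup hw σ D hD q A 0 = 1 := expSemigroup_zero _ _
  have e2 : jumpSemigroup hw σ D hD q B 0 = 1 := expSemigroup_zero _ _
  simpa [e1, e2] using this

theorem jumpSemigroup_add (s t : ℝ) (u : lp (fun _ : Ω => ℝ) ∞) :
    jumpSemigroup hw σ D hD q B (s + t) u =
      jumpSemigroup hw σ D hD q B s (jumpSemigroup hw σ D hD q B t u) := by
  rw [jumpSemigroup, expSemigroup_add]; rfl

end Weighted

/-! ### A process with one jump size for each occupation number -/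

/-- The number of particles that leave a site with `n` particles. -/
def jumpSize (n : ℕ) : ℕ := if n < 2 then 0 else if n = 3 then 1 else if n = 4 then 3 else 2

/-- From a site with `n` particles, `jumpSize n` particles jump at rate one. -/
def singleJumpRate (k n : ℕ) : ℝ := if 1 ≤ k ∧ k = jumpSize n then 1 else 0

theorem jumpSize_le (n : ℕ) : jumpSize n ≤ n := by
  unfold jumpSize; split_ifs <;> omega

theorem jumpSize_le_three (n : ℕ) : jumpSize n ≤ 3 := by
  unfold jumpSize; split_ifs <;> omega

/-- Two configurations are coupled by letting the same pair jump in both; this bound on the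
difference of jump sizes keeps them close. -/
theorem abs_jumpSize_sub_le (m n : ℕ) :
    |(jumpSize m : ℝ) - jumpSize n| ≤ 2 * |(m : ℝ) - n| := by
  have h : |(jumpSize m : ℤ) - jumpSize n| ≤ 2 * |(m : ℤ) - n| := by
    rcases lt_trichotomy m n with h | rfl | h
    · rw [abs_of_neg (a := (m : ℤ) - n) (by omega), abs_le]
      unfold jumpSize; split_ifs <;> omega
    · simp
    · rw [abs_of_pos (a := (m : ℤ) - n) (by omega), abs_le]
      unfold jumpSize; split_ifs <;> omega
  exact_mod_cast h

theorem isRate_singleJumpRate : IsRate (zeroRangeRate singleJumpRate) where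
  zero α β := by simp [zeroRangeRate, singleJumpRate]
  nonneg k α β _ _ := by unfold zeroRangeRate singleJumpRate; split_ifs <;> simp
  eq_zero k α β h := by
    have := jumpSize_le α
    simp only [zeroRangeRate, singleJumpRate]
    rw [if_neg (by omega)]

theorem sum_mul_singleJumpRate_le (n : ℕ) :
    ∑ k ∈ Finset.Icc 1 n, (k : ℝ) * singleJumpRate k n ≤ 1 * n := by
  have h : ∀ k ∈ Finset.Icc 1 n, (k : ℝ) * singleJumpRate k n =
      if k = jumpSize n then (k : ℝ) else 0 := fun k hk => by
    simp [singleJumpRate, (Finset.mem_Icc.1 hk).1]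
  rw [Finset.sum_congr rfl h, Finset.sum_ite_eq', one_mul]
  split_ifs
  · exact_mod_cast jumpSize_le n
  · exact Nat.cast_nonneg n

theorem hasLinearGrowth_singleJumpRate : HasLinearGrowth (zeroRangeRate singleJumpRate) :=
  ⟨1, one_pos, fun α β _ => (sum_mul_singleJumpRate_le α).trans (by
    rw [one_mul, one_mul]; exact le_add_of_nonneg_right (Nat.cast_nonneg β))⟩

section Move

variable [DecidableEq X]

/-- The jump from `x` to `y`. -/
def Config.move (z : X × X) (η : Config a) : Config a :=
  Config.jump z.1 z.2 (jumpSize (η.1 z.1)) η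

theorem Config.jump_zero (x y : X) (η : Config a) : Config.jump x y 0 η = η := by
  apply Subtype.ext; funext z
  rw [Config.jump_apply]
  split_ifs with h1 h2 h3 <;> simp_all

theorem pairGen_singleJumpRate (x y : X) (f : Config a → ℝ) (η : Config a) :
    pairGen singleJumpRate x y f η = f (Config.move (x, y) η) - f η := by
  unfold pairGen
  have h : ∀ k ∈ Finset.Icc 1 (η.1 x), singleJumpRate k (η.1 x) * (f (Config.jump x y k η) - f η) =
      if k = jumpSize (η.1 x) then f (Config.jump x y k η) - f η else 0 := fun k hk => by
    simp [singleJumpRate, (Finset.mem_Icc.1 hk).1]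
  rw [Finset.sum_congr rfl h, Finset.sum_ite_eq']
  split_ifs with h1
  · rfl
  · have : jumpSize (η.1 x) = 0 := by
      have := jumpSize_le (η.1 x)
      rw [Finset.mem_Icc] at h1
      omega
    rw [Config.move, this, Config.jump_zero, sub_self]

variable (ha : ∀ x, 0 < a x)
include ha

theorem distance_move_self_le (z : X × X) (η : Config a) :
    distance (Config.move z η) η ≤ 3 * (a z.1 + a z.2) :=
  (distance_jump_le ha _ _ _ _).trans (mul_le_mul_of_nonneg_right
    (by exact_mod_cast jumpSize_le_three _) (add_nonneg (ha _).le (ha _).le))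

/-- The same pair jumps in both configurations, so the difference changes only at its two sites, and
there by at most the difference of the jump sizes. -/
theorem distance_move_le (z : X × X) (η ζ : Config a) :
    distance (Config.move z η) (Config.move z ζ) ≤
      distance η ζ + 2 * (|(η.1 z.1 : ℝ) - ζ.1 z.1| * (a z.1 + a z.2)) := by
  obtain ⟨x, y⟩ := z
  simp only
  set δ := |(η.1 x : ℝ) - ζ.1 x| with hδ
  have hδ0 : 0 ≤ δ := abs_nonneg _
  have h := ((hasSum_ite_eq x (2 * δ * a x)).add (hasSum_ite_eq y (2 * δ * a y)))
  have h2 := distance_le_of_hasSum ha (η := Config.move (x, y) η) (ζ := Config.move (x, y) ζ)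
    ((summable_distance ha η ζ).hasSum.add h) fun u => ?_
  · refine h2.trans (le_of_eq ?_)
    simp only [distance]; ring
  have hx : 0 ≤ 2 * δ * a x := mul_nonneg (by positivity) (ha x).le
  have hy : 0 ≤ 2 * δ * a y := mul_nonneg (by positivity) (ha y).le
  have hκ := abs_jumpSize_sub_le (η.1 x) (ζ.1 x)
  rw [← hδ] at hκ
  have hη := jumpSize_le (η.1 x)
  have hζ := jumpSize_le (ζ.1 x)
  unfold Config.move
  rw [Config.jump_apply, Config.jump_apply]
  simp only [not_lt.2 hη, not_lt.2 hζ, or_false]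
  have hbase : 0 ≤ |(η.1 u : ℝ) - ζ.1 u| * a u := mul_nonneg (abs_nonneg _) (ha u).le
  by_cases hxy : x = y
  · rw [if_pos hxy, if_pos hxy]
    refine le_add_of_nonneg_right (add_nonneg ?_ ?_) <;> split_ifs <;> simp_all
  rw [if_neg hxy, if_neg hxy]
  by_cases hux : u = x
  · subst hux
    simp only [if_true, if_neg hxy, add_zero]
    rw [Nat.cast_sub hη, Nat.cast_sub hζ, ← add_mul]
    refine mul_le_mul_of_nonneg_right ?_ (ha u).le
    calc _ = |((η.1 u : ℝ) - ζ.1 u) - ((jumpSize (η.1 u) : ℝ) - jumpSize (ζ.1 u))| := by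
          congr 1; ring
      _ ≤ _ := (abs_sub _ _).trans (add_le_add le_rfl hκ)
  · rw [if_neg hux, if_neg hux, if_neg hux, zero_add]
    by_cases huy : u = y
    · subst huy
      simp only [if_true]
      push_cast
      rw [← add_mul]
      refine mul_le_mul_of_nonneg_right ?_ (ha u).le
      calc _ = |((η.1 u : ℝ) - ζ.1 u) + ((jumpSize (η.1 x) : ℝ) - jumpSize (ζ.1 x))| := by
            congr 1; ring
        _ ≤ _ := (abs_add_le _ _).trans (add_le_add le_rfl hκ)
    · simp [huy]

end Move

/-! ### Lipschitz functions as functions of weighted growth -/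

/-- The weight `1 + ‖η‖`. -/
noncomputable def weight (η : Config a) : ℝ := 1 + mass η

theorem one_le_weight (ha : ∀ x, 0 < a x) (η : Config a) : 1 ≤ weight η :=
  le_add_of_nonneg_right (mass_nonneg ha η)

theorem weight_move_le [DecidableEq X] (ha : ∀ x, 0 < a x) (z : X × X) (η : Config a) :
    weight (Config.move z η) ≤ (1 + 3 * (a z.1 + a z.2)) * weight η := by
  have h1 := mass_le_add_distance ha (Config.move z η) η
  have h2 := distance_move_self_le ha z η
  have h3 := one_le_weight ha η
  have h4 : 0 ≤ 3 * (a z.1 + a z.2) :=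
    mul_nonneg (by norm_num) (add_nonneg (ha _).le (ha _).le)
  have h5 := mul_le_mul_of_nonneg_left h3 h4
  unfold weight at *
  linarith

/-- The element of the weighted space given by a Lipschitz function. -/
noncomputable def toWeighted (ha : ∀ x, 0 < a x) (f : Lip a) : lp (fun _ : Config a => ℝ) ∞ :=
  ⟨fun η => f.1 η / weight η, memℓp_infty (by
    obtain ⟨K, hK⟩ := f.2
    refine ⟨|f.1 Config.empty| + K, ?_⟩
    rintro _ ⟨η, rfl⟩
    have hw := one_le_weight ha η
    have hw0 : 0 < weight η := zero_lt_one.trans_le hw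
    simp only
    rw [norm_div, Real.norm_eq_abs, Real.norm_eq_abs, abs_of_pos hw0, div_le_iff₀ hw0, add_mul]
    refine (hK.abs_le η).trans (add_le_add ?_ ?_)
    · exact le_mul_of_one_le_right (abs_nonneg _) hw
    · exact mul_le_mul_of_nonneg_left (by unfold weight; linarith) hK.1)⟩

theorem weightedEval_toWeighted (ha : ∀ x, 0 < a x) (f : Lip a) (η : Config a) :
    weightedEval weight η (toWeighted ha f) = f.1 η := by
  have hw0 : weight η ≠ 0 := (zero_lt_one.trans_le (one_le_weight ha η)).ne'
  change weight η * (f.1 η / weight η) = f.1 η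
  field_simp

theorem toWeighted_add (ha : ∀ x, 0 < a x) (f h : Lip a) :
    toWeighted ha (f + h) = toWeighted ha f + toWeighted ha h := by
  ext η
  change (f.1 η + h.1 η) / weight η = f.1 η / weight η + h.1 η / weight η
  ring

theorem toWeighted_smul (ha : ∀ x, 0 < a x) (r : ℝ) (f : Lip a) :
    toWeighted ha (r • f) = r • toWeighted ha f := by
  ext η
  change (r * f.1 η) / weight η = r * (f.1 η / weight η)
  ring

/-! ### The semigroup in infinite volume -/

theorem summable_move {p : X → X → ℝ} {M : ℝ} (ha : IsWeight p a) (hp : IsIrreducibleTransition p)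
    (hM : ∀ x, ∑' y, p x y * a y ≤ M * a x) :
    Summable fun z : X × X => p z.1 z.2 * (3 * (a z.1 + a z.2)) := by
  refine ((ha.summable_pair hp hM (c := fun _ => 1) (fun _ => zero_le_one)
    (by simpa using ha.summable)).1.mul_left 3).congr fun z => by ring

theorem tendsto_tail {p : X → X → ℝ} {M : ℝ} (ha : IsWeight p a) (hp : IsIrreducibleTransition p)
    (hM : ∀ x, ∑' y, p x y * a y ≤ M * a x) (r : ℝ) :
    Tendsto (fun A : Finset (X × X) => r * (∑' z : X × X, p z.1 z.2 * (3 * (a z.1 + a z.2)) -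
      ∑ z ∈ A, p z.1 z.2 * (3 * (a z.1 + a z.2)))) atTop (𝓝 0) := by
  have h : Tendsto (fun A : Finset (X × X) => ∑ z ∈ A, p z.1 z.2 * (3 * (a z.1 + a z.2))) atTop
    (𝓝 (∑' z : X × X, p z.1 z.2 * (3 * (a z.1 + a z.2)))) := (summable_move ha hp hM).hasSum
  have := (h.const_sub (∑' z : X × X, p z.1 z.2 * (3 * (a z.1 + a z.2)))).const_mul r
  simpa using this

section Construction

variable [DecidableEq X] {p : X → X → ℝ} {M : ℝ}

/-- The process in which only the jumps in `B` take place. -/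
noncomputable def finiteSemigroup (ha : ∀ x, 0 < a x) (p : X → X → ℝ) (B : Finset (X × X)) (t : ℝ) :
    lp (fun _ : Config a => ℝ) ∞ →L[ℝ] lp (fun _ : Config a => ℝ) ∞ :=
  jumpSemigroup (one_le_weight ha) Config.move (fun z => 1 + 3 * (a z.1 + a z.2))
    (weight_move_le ha) (fun z => p z.1 z.2) B t

/-- The value at `η` of the finite semigroup applied to `f`. -/
noncomputable def finiteValue (ha : ∀ x, 0 < a x) (p : X → X → ℝ) (B : Finset (X × X)) (t : ℝ)
    (f : Lip a) (η : Config a) : ℝ :=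
  weightedEval weight η (finiteSemigroup ha p B t (toWeighted ha f))

/-- The value at `η` of the infinite volume semigroup applied to `f`. -/
noncomputable def limitValue (ha : ∀ x, 0 < a x) (p : X → X → ℝ) (t : ℝ)
    (f : Lip a) (η : Config a) : ℝ :=
  limUnder atTop fun B : Finset (X × X) => finiteValue ha p B t f η

variable (ha : IsWeight p a) (hp : IsIrreducibleTransition p)
  (hM : ∀ x, ∑' y, p x y * a y ≤ M * a x)

include ha hp hM

/-- The excess over the total rate is controlled by the weight condition, uniformly in B; this gives
Lipschitz growth that survives the limit. -/
theorem sum_distance_move_le (B : Finset (X × X)) (η ζ : Config a) :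
    ∑ z ∈ B, p z.1 z.2 * distance (Config.move z η) (Config.move z ζ) ≤
      (∑ z ∈ B, p z.1 z.2 + 2 * (1 + M)) * distance η ζ := by
  have h := ha.summable_pair hp hM (c := fun x => |(η.1 x : ℝ) - ζ.1 x|) (fun _ => abs_nonneg _)
    (summable_distance ha.pos η ζ)
  have h1 := h.1.sum_le_tsum B fun z _ => mul_nonneg (hp.nonneg _ _)
    (mul_nonneg (abs_nonneg _) (add_nonneg (ha.pos _).le (ha.pos _).le))
  have h2 := h1.trans h.2
  calc _ ≤ ∑ z ∈ B, (p z.1 z.2 * distance η ζ +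
        2 * (p z.1 z.2 * (|(η.1 z.1 : ℝ) - ζ.1 z.1| * (a z.1 + a z.2)))) :=
        Finset.sum_le_sum fun z _ => (mul_le_mul_of_nonneg_left (distance_move_le ha.pos z η ζ)
          (hp.nonneg _ _)).trans (le_of_eq (by ring))
    _ = (∑ z ∈ B, p z.1 z.2) * distance η ζ +
        2 * ∑ z ∈ B, (p z.1 z.2 * (|(η.1 z.1 : ℝ) - ζ.1 z.1| * (a z.1 + a z.2))) := by
        rw [Finset.sum_add_distrib, Finset.sum_mul, Finset.mul_sum]
    _ ≤ _ := by unfold distance; linarith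

theorem isLipConst_finiteValue (hM0 : 0 ≤ M) (B : Finset (X × X)) {f : Lip a} {K : ℝ}
    (hf : IsLipConst f.1 K) {t : ℝ} (ht : 0 ≤ t) :
    IsLipConst (finiteValue ha.pos p B t f) (K * Real.exp (2 * (1 + M) * t)) :=
  ⟨mul_nonneg hf.1 (Real.exp_pos _).le, fun η ζ =>
    abs_jumpSemigroup_sub_le (fun _ => hp.nonneg _ _) (by positivity)
      (sum_distance_move_le ha hp hM B) hf.1
      (fun η ζ => by simp only [weightedEval_toWeighted]; exact hf.2 η ζ) ht η ζ⟩

/-- Duhamel's formula with jump displacements at most 3 (a x + a y). The bound is the tail of a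
convergent series, uniform in B and in the configuration. -/
theorem abs_finiteValue_sub_le (hM0 : 0 ≤ M) {A B : Finset (X × X)} (hAB : A ⊆ B) {f : Lip a}
    {K : ℝ} (hf : IsLipConst f.1 K) {t : ℝ} (ht : 0 ≤ t) (η : Config a) :
    |finiteValue ha.pos p B t f η - finiteValue ha.pos p A t f η| ≤
      (K * Real.exp (2 * (1 + M) * t) * t) *
        (∑' z : X × X, p z.1 z.2 * (3 * (a z.1 + a z.2)) -
          ∑ z ∈ A, p z.1 z.2 * (3 * (a z.1 + a z.2))) := by
  have hpos : ∀ z : X × X, 0 ≤ p z.1 z.2 * (3 * (a z.1 + a z.2)) := fun z =>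
    mul_nonneg (hp.nonneg _ _) (mul_nonneg (by norm_num) (add_nonneg (ha.pos _).le (ha.pos _).le))
  have h := abs_jumpSemigroup_sub_jumpSemigroup_le (hw := one_le_weight ha.pos)
    (hD := weight_move_le ha.pos) (q := fun z : X × X => p z.1 z.2) (u := toWeighted ha.pos f)
    (fun _ => hp.nonneg _ _) hAB ht
    (b := fun z => (K * Real.exp (2 * (1 + M) * t)) * (3 * (a z.1 + a z.2)))
    (fun s hs hst z ζ => by
      refine ((isLipConst_finiteValue ha hp hM hM0 B hf hs).2 _ _).trans ?_
      refine mul_le_mul (mul_le_mul_of_nonneg_left (Real.exp_le_exp.2 ?_) hf.1)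
        (distance_move_self_le ha.pos z ζ) (distance_nonneg ha.pos _ _)
        (mul_nonneg hf.1 (Real.exp_pos _).le)
      exact mul_le_mul_of_nonneg_left hst (by positivity)) η
  refine h.trans ?_
  have h1 : ∑ z ∈ B \ A, p z.1 z.2 * (3 * (a z.1 + a z.2)) ≤
      ∑' z : X × X, p z.1 z.2 * (3 * (a z.1 + a z.2)) -
          ∑ z ∈ A, p z.1 z.2 * (3 * (a z.1 + a z.2)) := by
    have h2 := (summable_move ha hp hM).sum_le_tsum B fun z _ => hpos z
    rw [← Finset.sum_sdiff hAB] at h2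
    linarith
  have h3 : ∑ z ∈ B \ A, p z.1 z.2 * (K * Real.exp (2 * (1 + M) * t) * (3 * (a z.1 + a z.2))) =
      K * Real.exp (2 * (1 + M) * t) * ∑ z ∈ B \ A, p z.1 z.2 * (3 * (a z.1 + a z.2)) := by
    rw [Finset.mul_sum]; exact Finset.sum_congr rfl fun z _ => by ring
  rw [h3]
  have h4 := mul_le_mul_of_nonneg_left h1
    (mul_nonneg (mul_nonneg hf.1 (Real.exp_pos (2 * (1 + M) * t)).le) ht)
  linarith

theorem tendsto_finiteValue (hM0 : 0 ≤ M) (f : Lip a) {t : ℝ} (ht : 0 ≤ t) (η : Config a) :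
    Tendsto (fun B => finiteValue ha.pos p B t f η) atTop (𝓝 (limitValue ha.pos p t f η)) := by
  obtain ⟨K, hK⟩ := f.2
  refine tendsto_nhds_limUnder (cauchySeq_tendsto_of_complete
    (Metric.cauchySeq_iff'.2 fun ε hε => ?_))
  obtain ⟨A, hA⟩ := ((tendsto_tail ha hp hM
    (K * Real.exp (2 * (1 + M) * t) * t)).eventually (gt_mem_nhds hε)).exists
  refine ⟨A, fun B hB => ?_⟩
  rw [Real.dist_eq]
  exact (abs_finiteValue_sub_le ha hp hM hM0 hB hK ht η).trans_lt hA

theorem abs_limitValue_sub_le (hM0 : 0 ≤ M) (A : Finset (X × X)) {f : Lip a}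
    {K : ℝ} (hf : IsLipConst f.1 K) {t : ℝ} (ht : 0 ≤ t) (η : Config a) :
    |limitValue ha.pos p t f η - finiteValue ha.pos p A t f η| ≤
      (K * Real.exp (2 * (1 + M) * t) * t) *
        (∑' z : X × X, p z.1 z.2 * (3 * (a z.1 + a z.2)) -
          ∑ z ∈ A, p z.1 z.2 * (3 * (a z.1 + a z.2))) :=
  le_of_tendsto ((tendsto_finiteValue ha hp hM hM0 f ht η).sub_const _).abs
    ((eventually_ge_atTop A).mono fun _ hB => abs_finiteValue_sub_le ha hp hM hM0 hB hf ht η)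

theorem isLipConst_limitValue (hM0 : 0 ≤ M) {f : Lip a} {K : ℝ}
    (hf : IsLipConst f.1 K) {t : ℝ} (ht : 0 ≤ t) :
    IsLipConst (limitValue ha.pos p t f) (K * Real.exp (2 * (1 + M) * t)) :=
  ⟨mul_nonneg hf.1 (Real.exp_pos _).le, fun η ζ =>
    le_of_tendsto ((tendsto_finiteValue ha hp hM hM0 f ht η).sub
      (tendsto_finiteValue ha hp hM hM0 f ht ζ)).abs
      (Eventually.of_forall fun B => (isLipConst_finiteValue ha hp hM hM0 B hf ht).2 η ζ)⟩

/-- The infinite volume semigroup. -/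
noncomputable def limitSemigroup (hM0 : 0 ≤ M) (t : ℝ≥0) : Lip a →ₗ[ℝ] Lip a where
  toFun f := ⟨limitValue ha.pos p t f, by
    obtain ⟨K, hK⟩ := f.2
    exact ⟨_, isLipConst_limitValue ha hp hM hM0 hK t.2⟩⟩
  map_add' f h := by
    refine Subtype.ext (funext fun η => tendsto_nhds_unique
      (tendsto_finiteValue ha hp hM hM0 (f + h) t.2 η)
      (((tendsto_finiteValue ha hp hM hM0 f t.2 η).add
        (tendsto_finiteValue ha hp hM hM0 h t.2 η)).congr fun B => ?_))
    simp only [finiteValue, toWeighted_add, map_add]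
  map_smul' r f := by
    refine Subtype.ext (funext fun η => tendsto_nhds_unique
      (tendsto_finiteValue ha hp hM hM0 (r • f) t.2 η)
      (((tendsto_finiteValue ha hp hM hM0 f t.2 η).const_mul r).congr fun B => ?_))
    simp only [finiteValue, toWeighted_smul, map_smul, smul_eq_mul]

theorem limitSemigroup_apply (hM0 : 0 ≤ M) (t : ℝ≥0) (f : Lip a) (η : Config a) :
    (limitSemigroup ha hp hM hM0 t f).1 η = limitValue ha.pos p t f η := rfl

theorem limitSemigroup_zero (hM0 : 0 ≤ M) : limitSemigroup ha hp hM hM0 0 = LinearMap.id := by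
  refine LinearMap.ext fun f => Subtype.ext (funext fun η => ?_)
  refine tendsto_nhds_unique (tendsto_finiteValue ha hp hM hM0 f (0 : ℝ≥0).2 η)
    (tendsto_const_nhds.congr fun B => ?_)
  have h : finiteSemigroup ha.pos p B 0 = 1 := expSemigroup_zero _ _
  simp only [finiteValue, NNReal.val_eq_coe, NNReal.coe_zero, h, one_apply_eq_self,
    weightedEval_toWeighted]
  rfl

/-- For finite B the semigroup property is exact. Replacing S_B(t) f by its limit inside S_B(s)
costs at most their supremum distance, by contraction, and this distance is a vanishing tail. -/
theorem limitSemigroup_add (hM0 : 0 ≤ M) (s t : ℝ≥0) :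
    limitSemigroup ha hp hM hM0 (s + t) =
      limitSemigroup ha hp hM hM0 s ∘ₗ limitSemigroup ha hp hM hM0 t := by
  refine LinearMap.ext fun f => Subtype.ext (funext fun η => ?_)
  obtain ⟨K, hK⟩ := f.2
  set h := limitSemigroup ha hp hM hM0 t f with hh
  have h1 := tendsto_finiteValue ha hp hM hM0 f (s + t).2 η
  have h2 := tendsto_finiteValue ha hp hM hM0 h s.2 η
  refine tendsto_nhds_unique h1 ?_
  refine tendsto_of_tendsto_of_dist h2 ?_
  refine squeeze_zero (fun _ => dist_nonneg) (fun B => ?_)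
    (tendsto_tail ha hp hM (K * Real.exp (2 * (1 + M) * t) * t))
  have e : finiteValue ha.pos p B (s + t : ℝ≥0) f η = weightedEval weight η
      (finiteSemigroup ha.pos p B s (finiteSemigroup ha.pos p B t (toWeighted ha.pos f))) := by
    rw [finiteValue, NNReal.coe_add]
    exact congrArg _ (jumpSemigroup_add _ _ _)
  have e2 : finiteValue ha.pos p B s h η = weightedEval weight η
      (finiteSemigroup ha.pos p B s (toWeighted ha.pos h)) := rfl
  change dist (finiteValue ha.pos p B s h η) (finiteValue ha.pos p B (s + t : ℝ≥0) f η) ≤ _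
  rw [Real.dist_eq, e, e2, ← map_sub, ← map_sub]
  refine abs_jumpSemigroup_le (fun _ => hp.nonneg _ _) (fun ζ => ?_) s.2 η
  rw [map_sub, weightedEval_toWeighted]
  exact abs_limitValue_sub_le ha hp hM hM0 B hK t.2 ζ

/-- Dominated convergence for series: the finite sums are extended by zero, and the uniform
Lipschitz constant supplies the summable bound. -/
theorem tendsto_sum_finiteValue (hM0 : 0 ≤ M) (f : Lip a) {t : ℝ} (ht : 0 ≤ t) (η : Config a) :
    Tendsto (fun B => ∑ z ∈ B, p z.1 z.2 * (finiteValue ha.pos p B t f (Config.move z η) -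
        finiteValue ha.pos p B t f η)) atTop
      (𝓝 (∑' z : X × X, p z.1 z.2 * (limitValue ha.pos p t f (Config.move z η) -
        limitValue ha.pos p t f η))) := by
  obtain ⟨K, hK⟩ := f.2
  have h := tendsto_tsum_of_dominated_convergence
    (f := fun (B : Finset (X × X)) z => if z ∈ B then p z.1 z.2 *
      (finiteValue ha.pos p B t f (Config.move z η) - finiteValue ha.pos p B t f η) else 0)
    (g := fun z => p z.1 z.2 * (limitValue ha.pos p t f (Config.move z η) -
        limitValue ha.pos p t f η)) (𝓕 := atTop)
    ((summable_move ha hp hM).mul_left (K * Real.exp (2 * (1 + M) * t)))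
    (fun z => ?_) (Eventually.of_forall fun B z => ?_)
  · refine h.congr fun B => ?_
    rw [tsum_eq_sum (s := B) fun z hz => if_neg hz]
    exact Finset.sum_congr rfl fun z hz => if_pos hz
  · refine (((tendsto_finiteValue ha hp hM hM0 f ht (Config.move z η)).sub
      (tendsto_finiteValue ha hp hM hM0 f ht η)).const_mul (p z.1 z.2)).congr' ?_
    filter_upwards [eventually_ge_atTop {z}] with B hB
    rw [if_pos (hB (Finset.mem_singleton_self z))]
  · have h0 : 0 ≤ K * Real.exp (2 * (1 + M) * t) * (p z.1 z.2 * (3 * (a z.1 + a z.2))) :=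
      mul_nonneg (mul_nonneg hK.1 (Real.exp_pos _).le) (mul_nonneg (hp.nonneg _ _)
        (mul_nonneg (by norm_num) (add_nonneg (ha.pos _).le (ha.pos _).le)))
    split_ifs
    · rw [norm_mul, Real.norm_eq_abs, Real.norm_eq_abs, abs_of_nonneg (hp.nonneg _ _)]
      have hL := isLipConst_finiteValue ha hp hM hM0 B hK ht
      refine (mul_le_mul_of_nonneg_left ((hL.2 _ _).trans
        (mul_le_mul_of_nonneg_left (distance_move_self_le ha.pos z η) hL.1))
        (hp.nonneg _ _)).trans (le_of_eq (by ring))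
    · simpa using h0

theorem abs_sum_finiteValue_le (hM0 : 0 ≤ M) {f : Lip a} {K : ℝ} (hf : IsLipConst f.1 K)
    {s t : ℝ} (hs : 0 ≤ s) (hst : s ≤ t) (η : Config a) (B : Finset (X × X)) :
    |∑ z ∈ B, p z.1 z.2 * (finiteValue ha.pos p B s f (Config.move z η) -
        finiteValue ha.pos p B s f η)| ≤ K * Real.exp (2 * (1 + M) * t) *
        ∑' z : X × X, p z.1 z.2 * (3 * (a z.1 + a z.2)) := by
  have hpos : ∀ z : X × X, 0 ≤ p z.1 z.2 * (3 * (a z.1 + a z.2)) := fun z =>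
    mul_nonneg (hp.nonneg _ _) (mul_nonneg (by norm_num) (add_nonneg (ha.pos _).le (ha.pos _).le))
  have hL := (isLipConst_finiteValue ha hp hM hM0 B hf hs).mono ha.pos
    (K' := K * Real.exp (2 * (1 + M) * t)) (mul_le_mul_of_nonneg_left
      (Real.exp_le_exp.2 (mul_le_mul_of_nonneg_left hst (by positivity))) hf.1)
  refine (Finset.abs_sum_le_sum_abs _ _).trans ?_
  calc _ ≤ ∑ z ∈ B, K * Real.exp (2 * (1 + M) * t) * (p z.1 z.2 * (3 * (a z.1 + a z.2))) :=
        Finset.sum_le_sum fun z _ => by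
          rw [abs_mul, abs_of_nonneg (hp.nonneg _ _)]
          refine (mul_le_mul_of_nonneg_left ((hL.2 _ _).trans
            (mul_le_mul_of_nonneg_left (distance_move_self_le ha.pos z η) hL.1))
            (hp.nonneg _ _)).trans (le_of_eq (by ring))
    _ = K * Real.exp (2 * (1 + M) * t) * ∑ z ∈ B, p z.1 z.2 * (3 * (a z.1 + a z.2)) := by
        rw [Finset.mul_sum]
    _ ≤ _ := mul_le_mul_of_nonneg_left ((summable_move ha hp hM).sum_le_tsum B fun z _ => hpos z) hL.1

theorem generator_singleJumpRate_limitSemigroup (hM0 : 0 ≤ M) (f : Lip a) (η : Config a) {s : ℝ}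
    (hs : 0 ≤ s) :
    generator p (zeroRangeRate singleJumpRate) (limitSemigroup ha hp hM hM0 s.toNNReal f).1 η =
      ∑' z : X × X, p z.1 z.2 * (limitValue ha.pos p s f (Config.move z η) -
        limitValue ha.pos p s f η) := by
  rw [generator_zeroRange]
  refine tsum_congr fun z => ?_
  rw [pairGen_singleJumpRate, limitSemigroup_apply, limitSemigroup_apply, Real.coe_toNNReal _ hs]

/-- For finite B the equation is the fundamental theorem of calculus. Its integrand converges
pointwise and is bounded on [0, t] uniformly in B, so the equation passes to the limit. -/
theorem limitSemigroup_kolmogorov [Countable X] (hM0 : 0 ≤ M) (t : ℝ≥0) (f : Lip a)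
    (η : Config a) :
    IntervalIntegrable (fun s : ℝ => generator p (zeroRangeRate singleJumpRate)
        (limitSemigroup ha hp hM hM0 s.toNNReal f).1 η) volume 0 t ∧
      (limitSemigroup ha hp hM hM0 t f).1 η = f.1 η + ∫ s in (0 : ℝ)..t,
        generator p (zeroRangeRate singleJumpRate)
          (limitSemigroup ha hp hM hM0 s.toNNReal f).1 η := by
  obtain ⟨K, hK⟩ := f.2
  set G : ℝ → ℝ := fun s => generator p (zeroRangeRate singleJumpRate)
        (limitSemigroup ha hp hM hM0 s.toNNReal f).1 η with hG
  set G' : Finset (X × X) → ℝ → ℝ := fun B s => ∑ z ∈ B, p z.1 z.2 *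
    (finiteValue ha.pos p B s f (Config.move z η) - finiteValue ha.pos p B s f η) with hG'
  set R : ℝ := K * Real.exp (2 * (1 + M) * t) *
    ∑' z : X × X, p z.1 z.2 * (3 * (a z.1 + a z.2)) with hR
  have hder : ∀ B s ζ, HasDerivAt (fun s => finiteValue ha.pos p B s f ζ)
      (∑ z ∈ B, p z.1 z.2 * (finiteValue ha.pos p B s f (Config.move z ζ) -
        finiteValue ha.pos p B s f ζ)) s := fun B s ζ =>
    hasDerivAt_jumpSemigroup (toWeighted ha.pos f) ζ s
  have hcont : ∀ B ζ, Continuous fun s => finiteValue ha.pos p B s f ζ := fun B ζ =>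
    continuous_iff_continuousAt.2 fun s => (hder B s ζ).continuousAt
  have hGc : ∀ B, Continuous (G' B) := fun B => continuous_finsetSum _ fun z _ =>
    continuous_const.mul ((hcont B _).sub (hcont B _))
  have hbd : ∀ B s, s ∈ Set.uIoc (0 : ℝ) t → ‖G' B s‖ ≤ R := fun B s hs => by
    rw [Set.uIoc_of_le t.coe_nonneg] at hs
    exact abs_sum_finiteValue_le ha hp hM hM0 hK hs.1.le hs.2 η B
  have hlim : ∀ s, s ∈ Set.uIoc (0 : ℝ) t → Tendsto (fun B => G' B s) atTop (𝓝 (G s)) :=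
    fun s hs => by
      rw [Set.uIoc_of_le t.coe_nonneg] at hs
      simp only [hG]
      rw [generator_singleJumpRate_limitSemigroup ha hp hM hM0 f η hs.1.le]
      exact tendsto_sum_finiteValue ha hp hM hM0 f hs.1.le η
  refine ⟨?_, ?_⟩
  · rw [intervalIntegrable_iff]
    have hmeas : AEStronglyMeasurable G (volume.restrict (Set.uIoc (0 : ℝ) t)) :=
      aestronglyMeasurable_of_tendsto_ae atTop (fun B => (hGc B).aestronglyMeasurable)
        ((ae_restrict_iff' measurableSet_uIoc).2 (Eventually.of_forall hlim))
    have : IsFiniteMeasure (volume.restrict (Set.uIoc (0 : ℝ) t)) := by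
      rw [Set.uIoc_of_le t.coe_nonneg]; infer_instance
    refine Integrable.of_bound hmeas R ?_
    refine (ae_restrict_iff' measurableSet_uIoc).2 (Eventually.of_forall fun s hs => ?_)
    exact le_of_tendsto (hlim s hs).norm (Eventually.of_forall fun B => hbd B s hs)
  · have h1 := intervalIntegral.tendsto_integral_filter_of_dominated_convergence
      (μ := volume) (a := (0 : ℝ)) (b := t) (l := atTop) (F := G') (f := G) (fun _ => R)
      (Eventually.of_forall fun B => (hGc B).aestronglyMeasurable)
      (Eventually.of_forall fun B => Eventually.of_forall (hbd B)) intervalIntegrable_const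
      (Eventually.of_forall hlim)
    refine tendsto_nhds_unique (tendsto_finiteValue ha hp hM hM0 f t.2 η)
      ((h1.const_add (f.1 η)).congr fun B => ?_)
    have h2 := intervalIntegral.integral_eq_sub_of_hasDerivAt (a := (0 : ℝ)) (b := t)
      (fun s _ => hder B s η) ((hGc B).intervalIntegrable _ _)
    have h3 : finiteValue ha.pos p B 0 f η = f.1 η := by
      have h : finiteSemigroup ha.pos p B 0 = 1 := expSemigroup_zero _ _
      rw [finiteValue, h, one_apply_eq_self, weightedEval_toWeighted]
    rw [h3] at h2
    change f.1 η + ∫ s in (0 : ℝ)..t, G' B s = finiteValue ha.pos p B t f η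
    rw [h2]; ring

theorem isMarkovSemigroup_limitSemigroup [Countable X] (hM0 : 0 ≤ M) :
    IsMarkovSemigroup p (zeroRangeRate singleJumpRate) (limitSemigroup ha hp hM hM0) where
  zero := limitSemigroup_zero ha hp hM hM0
  add := limitSemigroup_add ha hp hM hM0
  nonneg t f hf η := ge_of_tendsto (tendsto_finiteValue ha hp hM hM0 f t.2 η)
    (Eventually.of_forall fun B => jumpSemigroup_nonneg (fun _ => hp.nonneg _ _)
      (fun ζ => by rw [weightedEval_toWeighted]; exact hf ζ) t.2 η)
  one t f hf η := tendsto_nhds_unique (tendsto_finiteValue ha hp hM hM0 f t.2 η)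
    (tendsto_const_nhds.congr fun B => (jumpSemigroup_const
      (fun ζ => by rw [weightedEval_toWeighted]; exact hf ζ) _ η).symm)
  lipschitz := ⟨2 * (1 + M), fun t _ _ hf => isLipConst_limitValue ha hp hM hM0 hf t.2⟩
  kolmogorov := limitSemigroup_kolmogorov ha hp hM hM0

end Construction

/-! ### Invariance of the geometric product measure for `singleJumpRate` -/

/-- Two particles jump together at rate one. -/
def doubleJumpRate (k n : ℕ) : ℝ := if k = 2 ∧ 2 ≤ n then 1 else 0

theorem isRate_doubleJumpRate : IsRate (zeroRangeRate doubleJumpRate) where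
  zero α β := by simp [zeroRangeRate, doubleJumpRate]
  nonneg k α β _ _ := by unfold zeroRangeRate doubleJumpRate; split_ifs <;> simp
  eq_zero k α β h := by
    simp only [zeroRangeRate, doubleJumpRate]
    rw [if_neg (by omega)]

theorem sum_mul_doubleJumpRate_le (n : ℕ) :
    ∑ k ∈ Finset.Icc 1 n, (k : ℝ) * doubleJumpRate k n ≤ 1 * n := by
  have h : ∀ k ∈ Finset.Icc 1 n, (k : ℝ) * doubleJumpRate k n =
      if k = 2 then (k : ℝ) else 0 := fun k hk => by
    have hk := (Finset.mem_Icc.1 hk).2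
    by_cases h2 : k = 2
    · subst h2; simp [doubleJumpRate, hk]
    · simp [doubleJumpRate, h2]
  rw [Finset.sum_congr rfl h, Finset.sum_ite_eq', one_mul]
  split_ifs with h2
  · exact_mod_cast (Finset.mem_Icc.1 h2).2
  · exact Nat.cast_nonneg n

theorem doubleJumpRate_shift {μ : Measure ℕ} (hgeo : ∀ n, μ.real {n} = (1 / 2) ^ (n + 1)) (k j : ℕ) :
    doubleJumpRate k (j + k) * μ.real {j + k} =
      (if k = 2 then 1 / 4 else 0) * μ.real {j} := by
  rw [hgeo, hgeo]
  by_cases h : k = 2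
  · subst h
    simp only [doubleJumpRate, le_add_iff_nonneg_left, zero_le, and_self, if_true]
    ring
  · simp [doubleJumpRate, h]

/-! ### Comparison of the perturbed rates with double jumps. -/

section Perturbation

variable [DecidableEq X]

theorem pairGen_doubleJumpRate (x y : X) (f : Config a → ℝ) (η : Config a) :
    pairGen doubleJumpRate x y f η =
      if 2 ≤ η.1 x then f (Config.jump x y 2 η) - f η else 0 := by
  unfold pairGen
  have h : ∀ k ∈ Finset.Icc 1 (η.1 x), doubleJumpRate k (η.1 x) * (f (Config.jump x y k η) - f η) =
      if k = 2 then f (Config.jump x y k η) - f η else 0 := fun k hk => by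
    have hk := (Finset.mem_Icc.1 hk).2
    by_cases h2 : k = 2
    · subst h2; simp [doubleJumpRate, hk]
    · simp [doubleJumpRate, h2]
  rw [Finset.sum_congr rfl h, Finset.sum_ite_eq']
  simp [Finset.mem_Icc]

theorem pairGen_singleJumpRate_eq (x y : X) (f : Config a → ℝ) (η : Config a) :
    pairGen singleJumpRate x y f η = pairGen doubleJumpRate x y f η +
      ((if η.1 x = 3 then 1 else 0) * (f (Config.jump x y 1 η) - f (Config.jump x y 2 η)) +
        (if η.1 x = 4 then 1 else 0) * (f (Config.jump x y 3 η) - f (Config.jump x y 2 η))) := by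
  rw [pairGen_singleJumpRate, pairGen_doubleJumpRate, Config.move]
  simp only [jumpSize]
  by_cases h3 : η.1 x = 3
  · simp [h3]
  by_cases h4 : η.1 x = 4
  · simp [h4]
  by_cases h2 : 2 ≤ η.1 x
  · simp [h3, h4, h2, not_lt.2 h2]
  · simp [h3, h4, h2, not_le.1 h2, Config.jump_zero]

theorem Config.jump_upd_self {x y : X} (h : x ≠ y) {k n : ℕ} (hk : k ≤ n) (η : Config a) :
    Config.jump x y k (Config.upd x n η) = Config.addAt y k (Config.upd x (n - k) η) := by
  rw [Config.jump_eq h (by simpa [Config.upd_apply] using hk), Config.upd_upd]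
  simp [Config.upd_apply]

theorem Config.addAt_upd_addAt {x y : X} (h : x ≠ y) (j k n : ℕ) (η : Config a) :
    Config.addAt y k (Config.upd x n (Config.addAt y j η)) =
      Config.addAt y (j + k) (Config.upd x n η) := by
  apply Subtype.ext; funext z
  simp only [Config.addAt_apply, Config.upd_apply, if_neg h.symm, if_true]
  split_ifs <;> omega

theorem Config.addAt_upd_upd {x y : X} (h : x ≠ y) (k m n : ℕ) (η : Config a) :
    Config.addAt y k (Config.upd x n (Config.upd y m η)) =
      Config.upd y (m + k) (Config.upd x n η) := by
  apply Subtype.ext; funext z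
  simp only [Config.addAt_apply, Config.upd_apply, if_neg h.symm, if_true]
  split_ifs <;> omega

variable [Countable X] {p : X → X → ℝ} (ha : IsWeight p a) (μ : Measure ℕ) [IsProbabilityMeasure μ]
  (hμ : Integrable (fun n : ℕ => (n : ℝ)) μ) (hgeo : ∀ n, μ.real {n} = (1 / 2) ^ (n + 1))
  {f : Config a → ℝ} {K : ℝ} (hf : IsLipConst f K)

include ha hμ hgeo hf

/-- At occupation number 3 the change of jump size contributes μ(3) E Φ. At 4 it again leaves 1 or 2
particles at x, in the opposite order and with one more particle at y, and contributes -μ(4) E Φ(η +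
1 at y). For the geometric law this is -μ(3) E[Φ; η(y) ≥ 1], so only η(y) = 0 survives, with weight
μ(3) μ(0) = 1/32. What remains is antisymmetric in x and y. -/
theorem integral_pairGen_singleJumpRate {x y : X} (hxy : x ≠ y) :
    ∫ η, pairGen singleJumpRate x y f η ∂(configMeasure a μ) =
      ∫ η, pairGen doubleJumpRate x y f η ∂(configMeasure a μ) +
        1 / 32 * ∫ η, (f (Config.upd y 1 (Config.upd x 2 η)) -
          f (Config.upd y 2 (Config.upd x 1 η))) ∂(configMeasure a μ) := by
  have := isProbabilityMeasure_configMeasure ha.pos ha.summable μ hμ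
  have hmeas : ∀ j k, Measurable fun η => f (Config.jump x y j η) - f (Config.jump x y k η) :=
    fun j k => (hf.measurable.comp (measurable_jump x y j)).sub
      (hf.measurable.comp (measurable_jump x y k))
  have hbd : ∀ (j k : ℕ) η, |f (Config.jump x y j η) - f (Config.jump x y k η)| ≤
      K * (j * (a x + a y)) + K * (k * (a x + a y)) := fun j k η => by
    have h1 := hf.abs_jump_sub_le ha.pos x y j η
    have h2 := hf.abs_jump_sub_le ha.pos x y k η
    calc _ = |(f (Config.jump x y j η) - f η) - (f (Config.jump x y k η) - f η)| := by
          congr 1; ring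
      _ ≤ _ := (abs_sub _ _).trans (add_le_add h1 h2)
  have hupd : ∀ (z : X) (n : ℕ), Measurable fun η : Config a => Config.upd z n η := fun z n =>
    (measurable_upd z).comp (measurable_const.prodMk measurable_id)
  have hind : ∀ n, Integrable (fun m : ℕ => if m = n then (1 : ℝ) else 0) μ := fun n =>
    integrable_ite_eq μ n 1
  have hint : ∀ (z : X) (w : ℕ → ℝ) (Ψ : Config a → ℝ) (B : ℝ), Integrable w μ → Measurable Ψ →
      (∀ η, |Ψ η| ≤ B) → Integrable (fun η : Config a => w (η.1 z) * Ψ η) (configMeasure a μ) :=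
    fun z w Ψ B hw hΨ hB => (integrable_eval ha.pos ha.summable μ hμ z hw).mul_bdd (c := B)
      hΨ.aestronglyMeasurable (Eventually.of_forall hB)
  set Φ : Config a → ℝ := fun η => f (Config.addAt y 1 (Config.upd x 2 η)) -
    f (Config.addAt y 2 (Config.upd x 1 η)) with hΦ
  have hΦ3 : ∀ η, f (Config.jump x y 1 (Config.upd x 3 η)) -
      f (Config.jump x y 2 (Config.upd x 3 η)) = Φ η := fun η => by
    rw [Config.jump_upd_self hxy (by norm_num), Config.jump_upd_self hxy (by norm_num)]
  have hΦ4 : ∀ η, f (Config.jump x y 3 (Config.upd x 4 η)) -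
      f (Config.jump x y 2 (Config.upd x 4 η)) = -Φ (Config.addAt y 1 η) := fun η => by
    rw [Config.jump_upd_self hxy (by norm_num), Config.jump_upd_self hxy (by norm_num), hΦ]
    simp only [Config.addAt_upd_addAt hxy]
    ring
  have hΦm : Measurable Φ := by
    have := (hmeas 1 2).comp (hupd x 3)
    rwa [show ((fun η => f (Config.jump x y 1 η) - f (Config.jump x y 2 η)) ∘
      fun η => Config.upd x 3 η) = Φ from funext hΦ3] at this
  obtain ⟨B, hB⟩ : ∃ B, ∀ η, |Φ η| ≤ B := ⟨_, fun η => by rw [← hΦ3]; exact hbd 1 2 _⟩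
  have e3 := integral_indicator_mul ha.pos ha.summable μ hμ x 3 (hmeas 1 2) (hbd 1 2)
  have e4 := integral_indicator_mul ha.pos ha.summable μ hμ x 4 (hmeas 3 2) (hbd 3 2)
  simp only [hΦ3] at e3
  simp only [hΦ4, integral_neg] at e4
  -- The weight is the indicator of η(y) ≥ 1; the geometric ratio 1/2 turns it into one added
  -- particle at y.
  have e5 := integral_weight_mul ha.pos ha.summable μ hμ y
    (w := fun n => 1 - if n = 0 then (1 : ℝ) else 0) (k := 1) (r := 1 / 2)
    ((integrable_const 1).sub (hind 0)) (fun n hn => by simp [Nat.lt_one_iff.1 hn])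
    (fun j => by rw [hgeo, hgeo]; simp; ring) hΦm hB
  have e6 : ∫ η : Config a, (1 - if η.1 y = 0 then (1 : ℝ) else 0) * Φ η ∂(configMeasure a μ) =
      ∫ η, Φ η ∂(configMeasure a μ) -
        ∫ η : Config a, (if η.1 y = 0 then (1 : ℝ) else 0) * Φ η ∂(configMeasure a μ) := by
    rw [← integral_sub (Integrable.of_bound hΦm.aestronglyMeasurable B (Eventually.of_forall hB))
      (hint y (fun n => if n = 0 then 1 else 0) Φ B (hind 0) hΦm hB)]
    exact integral_congr_ae (Eventually.of_forall fun η => by simp only; ring)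
  have e7 := integral_indicator_mul ha.pos ha.summable μ hμ y 0 hΦm hB
  have e8 : ∀ η, Φ (Config.upd y 0 η) = f (Config.upd y 1 (Config.upd x 2 η)) -
          f (Config.upd y 2 (Config.upd x 1 η)) := fun η => by
    simp only [hΦ, Config.addAt_upd_upd hxy, zero_add]
  simp only [e8] at e7
  simp_rw [pairGen_singleJumpRate_eq]
  have i3 := hint x (fun n => if n = 3 then 1 else 0) _ _ (hind 3) (hmeas 1 2) (hbd 1 2)
  have i4 := hint x (fun n => if n = 4 then 1 else 0) _ _ (hind 4) (hmeas 3 2) (hbd 3 2)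
  have i34 : Integrable (fun η : Config a =>
      (if η.1 x = 3 then 1 else 0) * (f (Config.jump x y 1 η) - f (Config.jump x y 2 η)) +
        (if η.1 x = 4 then 1 else 0) * (f (Config.jump x y 3 η) - f (Config.jump x y 2 η)))
      (configMeasure a μ) := i3.add i4
  rw [integral_add (integrable_pairGen ha isRate_doubleJumpRate sum_mul_doubleJumpRate_le μ hμ hf x y)
    i34, integral_add i3 i4, e3, e4, hgeo, hgeo]
  rw [e6, e7, hgeo] at e5
  linear_combination (1 / 16) * e5

variable (hp : IsIrreducibleTransition p) (hcol : ∀ y, HasSum (fun x => p x y) 1)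
  (hsym : IsSymmetric p)

include hp hcol hsym

/-- Double jumps satisfy the product condition and have mean zero. The remaining sum changes sign
under exchange of x and y because p is symmetric, so it equals its own negative. -/
theorem integral_generator_singleJumpRate :
    ∫ η, generator p (zeroRangeRate singleJumpRate) f η ∂(configMeasure a μ) = 0 := by
  obtain ⟨M, hM0, hM⟩ := ha.exists_row_le hp
  have h1 := hasSum_integral_generator ha hp hM isRate_singleJumpRate sum_mul_singleJumpRate_le μ hμ hf
  have h2 := hasSum_integral_pairGen_zero ha hp isRate_doubleJumpRate sum_mul_doubleJumpRate_le
    μ hμ hf hcol zero_le_one (fun k j _ => doubleJumpRate_shift hgeo k j)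
  have h3 := h1.sub h2
  rw [sub_zero] at h3
  have h4 := (Equiv.prodComm X X).hasSum_iff.2 h3
  have h5 := h4.unique (h3.neg.congr_fun fun z => ?_)
  · linarith
  · obtain ⟨x, y⟩ := z
    simp only [Function.comp, Equiv.prodComm_apply, Prod.swap]
    rcases eq_or_ne x y with rfl | hxy
    · simp [pairGen_self]
    · rw [integral_pairGen_singleJumpRate ha μ hμ hgeo hf hxy,
        integral_pairGen_singleJumpRate ha μ hμ hgeo hf hxy.symm, hsym y x]
      have e : ∫ η, (f (Config.upd x 1 (Config.upd y 2 η)) -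
          f (Config.upd x 2 (Config.upd y 1 η))) ∂(configMeasure a μ) =
          -∫ η, (f (Config.upd y 1 (Config.upd x 2 η)) -
          f (Config.upd y 2 (Config.upd x 1 η))) ∂(configMeasure a μ) := by
        rw [← integral_neg]
        refine integral_congr_ae (Eventually.of_forall fun η => ?_)
        simp only [Config.upd_comm hxy]
        ring
      rw [e]; ring

end Perturbation

theorem not_productCondition_singleJumpRate {μ : Measure ℕ}
    (hgeo : ∀ n, μ.real {n} = (1 / 2) ^ (n + 1)) : ¬ ProductCondition singleJumpRate μ := by
  intro h
  -- A single particle leaves occupation number 3 at rate one but never leaves occupation number 1,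
  -- so only the left side is nonzero.
  have := h 1 2 le_rfl one_le_two
  rw [hgeo, hgeo, hgeo, hgeo] at this
  norm_num [singleJumpRate, jumpSize] at this

/-- A geometric distribution on `ℕ` with finite first moment. -/
theorem exists_geometric : ∃ (μ : Measure ℕ) (_ : IsProbabilityMeasure μ),
    (∀ n, μ.real {n} = (1 / 2) ^ (n + 1)) ∧ Integrable (fun n : ℕ => (n : ℝ)) μ := by
  set q : unitInterval := ⟨1 / 2, by norm_num, by norm_num⟩ with hq
  have hq0 : q ≠ 0 := fun h => by
    have := congrArg Subtype.val h
    norm_num [hq] at this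
  refine ⟨ProbabilityTheory.geometricMeasure q, inferInstance, fun n => ?_, ?_⟩
  · rw [ProbabilityTheory.geometricMeasure_real_singleton hq0, hq]
    norm_num [pow_succ]
  · rw [ProbabilityTheory.integrable_geometricMeasure_iff hq0]
    have h := (summable_pow_mul_geometric_of_norm_lt_one (R := ℝ) (r := 1 / 2) 1
      (by norm_num)).mul_left (1 / 2)
    refine h.congr fun n => ?_
    rw [hq]
    norm_num
    ring

/-- Since p(x, y) = p(0, y - x), the column sum is the row sum at 0 after the substitution x ↦ y -
x. -/
theorem IsTranslationInvariant.hasSum_col {G : Type*} [AddCommGroup G] {p : G → G → ℝ}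
    (h : IsTranslationInvariant p) (hp : IsIrreducibleTransition p) (y : G) :
    HasSum (fun x => p x y) 1 := by
  have h1 := (Equiv.subLeft y).hasSum_iff.2 (hp.hasSum_one 0)
  refine h1.congr_fun fun x => ?_
  have := h x y (-x)
  rw [add_neg_cancel, ← sub_eq_add_neg] at this
  simpa using this.symm

end MassMigration

theorem proposition3p9 (d : ℕ) (p : (Fin d → ℤ) → (Fin d → ℤ) → ℝ) (a : (Fin d → ℤ) → ℝ)
    (hp : MassMigration.IsIrreducibleTransition p)
    (hinv : MassMigration.IsTranslationInvariant p)
    (ha : MassMigration.IsWeight p a) :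
    (¬ MassMigration.IsSymmetric p →
      ∀ (g : ℕ → ℕ → ℝ) (μ : MeasureTheory.Measure ℕ) [MeasureTheory.IsProbabilityMeasure μ]
        (S : NNReal → (MassMigration.Lip a →ₗ[ℝ] MassMigration.Lip a)),
        MassMigration.IsAdmissible g μ →
        MassMigration.IsMarkovSemigroup p (MassMigration.zeroRangeRate g) S →
        (MassMigration.IsInvariant S (MassMigration.productMeasure (Fin d → ℤ) μ) ↔
          MassMigration.ProductCondition g μ)) ∧
    (MassMigration.IsSymmetric p →
      (∀ (g : ℕ → ℕ → ℝ) (μ : MeasureTheory.Measure ℕ) [MeasureTheory.IsProbabilityMeasure μ]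
        (S : NNReal → (MassMigration.Lip a →ₗ[ℝ] MassMigration.Lip a)),
        MassMigration.IsAdmissible g μ →
        MassMigration.IsMarkovSemigroup p (MassMigration.zeroRangeRate g) S →
        MassMigration.ProductCondition g μ →
        MassMigration.IsInvariant S (MassMigration.productMeasure (Fin d → ℤ) μ)) ∧
      ∃ (g : ℕ → ℕ → ℝ) (μ : MeasureTheory.Measure ℕ) (_ : MeasureTheory.IsProbabilityMeasure μ)
        (S : NNReal → (MassMigration.Lip a →ₗ[ℝ] MassMigration.Lip a)),
        MassMigration.IsAdmissible g μ ∧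
        MassMigration.IsMarkovSemigroup p (MassMigration.zeroRangeRate g) S ∧
        MassMigration.IsInvariant S (MassMigration.productMeasure (Fin d → ℤ) μ) ∧
        ¬ MassMigration.ProductCondition g μ) := by
  have hcol := hinv.hasSum_col hp
  obtain ⟨M, hM0, hM⟩ := ha.exists_row_le hp
  have hsuff : ∀ (g : ℕ → ℕ → ℝ) (μ : MeasureTheory.Measure ℕ)
      [MeasureTheory.IsProbabilityMeasure μ]
      (S : NNReal → (MassMigration.Lip a →ₗ[ℝ] MassMigration.Lip a)),
      MassMigration.IsAdmissible g μ →
      MassMigration.IsMarkovSemigroup p (MassMigration.zeroRangeRate g) S →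
      MassMigration.ProductCondition g μ →
      MassMigration.IsInvariant S (MassMigration.productMeasure (Fin d → ℤ) μ) := by
    intro g μ _ S hg hS hcond
    obtain ⟨C, hC0, hC⟩ := hg.growth.exists_bound
    exact hS.isInvariant ha hp hM hg.rate hC μ hg.moment hC0.le fun f K hf =>
      (MassMigration.hasSum_integral_generator ha hp hM hg.rate hC μ hg.moment hf).unique
        (MassMigration.hasSum_integral_pairGen_zero ha hp hg.rate hC μ hg.moment hf hcol hC0.le
          (hcond.shift hg.zero_pos))
  refine ⟨fun hsym g μ _ S hg hS => ⟨fun hi => ?_, hsuff g μ S hg hS⟩, fun hsym => ⟨hsuff, ?_⟩⟩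
  · obtain ⟨C, hC0, hC⟩ := hg.growth.exists_bound
    exact MassMigration.productCondition_of_integral_generator ha hp hM hg.rate hC μ hg.moment hC0.le hg.zero_pos
      hsym fun f K hf hb =>
        hS.integral_generator_eq_zero ha hp hM hg.rate hC μ hg.moment hC0.le hi hf hb
  · obtain ⟨μ, hμ1, hgeo, hμ⟩ := MassMigration.exists_geometric
    have hS := MassMigration.isMarkovSemigroup_limitSemigroup ha hp hM hM0
    exact ⟨MassMigration.singleJumpRate, μ, hμ1, MassMigration.limitSemigroup ha hp hM hM0,
      ⟨MassMigration.isRate_singleJumpRate, MassMigration.hasLinearGrowth_singleJumpRate, by rw [hgeo]; norm_num, hμ⟩, hS,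
      hS.isInvariant ha hp hM MassMigration.isRate_singleJumpRate MassMigration.sum_mul_singleJumpRate_le μ hμ zero_le_one
        fun f K hf => MassMigration.integral_generator_singleJumpRate ha μ hμ hgeo hf hp hcol hsym,
      MassMigration.not_productCondition_singleJumpRate hgeo⟩
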